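/- Let $\lambda$ denote Lebesgue measure on $\mathbb{C}$ and let $\mathcal{P}(\mathbb{C})$ be the set of Borel probability measures on $\mathbb{C}$ with compact support. For $\mu\in\mathcal{P}(\mathbb{C})$ let $U_\mu:\mathbb{C}\to[-\infty,\infty)$, $U_\mu(z):=\int_{\mathbb{C}}\log|z-w|\,d\mu(w)$, be its logarithmic potential. For $K\subset\mathbb{C}$, say that $\mu$ is *supported on a circle centered in $K$* if there are $r\ge 0$ and $z\in K$ with $\operatorname{supp}(\mu)\subset\{w:|w-z|=r\}$. For $K\subset\mathbb{C}$ compact, say that $\mu,\nu\in\mathcal{P}(\mathbb{C})$ *satisfy Assumption 1 on $K$* if there is a finite constant $C>0$ such that $$\lambda\left(\left\{z\in K: |U_\mu(z)-U_\nu(z)|\le \frac{\log^2 n}{\sqrt n}\right\}\right)\le \frac{C}{\log^3 n}\qquad\text{for all integers } n>C.$$ **Theorem.** Let $m\ge 2$ be a fixed integer, let $\mu_1,\dots,\mu_m\in\mathcal{P}(\mathbb{C})$, and put $U(z):=\max_{1\le k\le m}U_{\mu_k}(z)$. Then $U$ is finite almost everywhere and locally integrable, and there is a (deterministic) probability measure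 $\rho$ on $\mathbb{C}$, depending only on $\mu_1,\dots,\mu_m$, such that $\rho=\frac1{2\pi}\Delta U$ in the sense of distributions, i.e. $$\int_{\mathbb{C}}\psi\,d\rho=\frac1{2\pi}\int_{\mathbb{C}}\Delta\psi(z)\,U(z)\,d\lambda(z)\qquad\text{for all smooth, compactly supported }\psi:\mathbb{C}\to\mathbb{C};$$ $\rho$ is the only locally finite Borel measure with this property. Moreover, let $\varphi:\mathbb{C}\to\mathbb{C}$ be smooth with compact support and assume that at least one of the following holds: 1. for each $1\le k\le m-1$, the measure $\mu_k$ is not supported on a circle centered in $\operatorname{supp}(\varphi)$; 2. for each $1\le k<l\le m$, the measures $\mu_k,\mu_l$ satisfy Assumption 1 on $\operatorname{supp}(\varphi)$. Let $\{X_{i,k}:1\le k\le m,\ i\ge 1\}$ be independent random variables such that $X_{i,k}$ has distribution $\mu_k$ for each $i\ge1$, and for $n\ge 1$ let $p_{n,k}(z):=\prod_{i=1}^n(z-X_{i,k})$. Then $$\frac1n\sum_{i=1}^n\varphi\big(z_i^{(n)}\big)\longrightarrow\int_{\mathbb{C}}\varphi\,d\rho$$ in probability as $n\to\infty$, where $z_1^{(n)},\dots,z_n^{(n)}$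 are the zeros, counted with multiplicity, of the sum $\sum_{k=1}^m p_{n,k}$. -/

import Mathlib

open MeasureTheory ProbabilityTheory Filter Topology Polynomial
open scoped ENNReal

noncomputable section

/-- The logarithmic potential `U_μ(z) = ∫ log |z - w| dμ(w)`, with values in the extended reals:
the integral of the positive part minus the integral of the negative part, where `log 0 = -∞`.
For compactly supported finite `μ` the first integral is finite. -/
def logPotential (μ : Measure ℂ) (z : ℂ) : EReal :=
  ((∫⁻ w, (ENNReal.log ‖z - w‖ₑ).toENNReal ∂μ : ℝ≥0∞) : EReal)
    - ((∫⁻ w, (-ENNReal.log ‖z - w‖ₑ).toENNReal ∂μ : ℝ≥0∞) : EReal)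

/-- The pointwise maximum of the logarithmic potentials of `μ_1, …, μ_m`. -/
def maxLogPotential {m : ℕ} (μ : Fin m → Measure ℂ) (z : ℂ) : EReal :=
  ⨆ k, logPotential (μ k) z

/-- `μ` is supported on a circle (possibly of radius zero) centered at a point of `K`. -/
def SupportedOnCircleCenteredIn (μ : Measure ℂ) (K : Set ℂ) : Prop :=
  ∃ r : ℝ, 0 ≤ r ∧ ∃ z ∈ K, μ.support ⊆ {w : ℂ | ‖w - z‖ = r}

/-- The potentials of `μ` and `ν` are separated on `K`: there is a finite `C > 0` such that, for all
`n > C`, the set of `z ∈ K` with `|U_μ(z) - U_ν(z)| ≤ log² n / √n` has Lebesgue measure at most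
`C / log³ n`. -/
def PotentialsSeparatedOn (μ ν : Measure ℂ) (K : Set ℂ) : Prop :=
  ∃ C : ℝ, 0 < C ∧ ∀ n : ℕ, C < n →
    volume {z ∈ K | (logPotential μ z - logPotential ν z).abs
        ≤ ENNReal.ofReal (Real.log n ^ 2 / Real.sqrt n)}
      ≤ ENNReal.ofReal (C / Real.log n ^ 3)

/-- `φ ∈ C_c^∞(ℂ)`, smoothness being that of functions of two real variables. -/
def IsTestFunction (φ : ℂ → ℂ) : Prop :=
  ContDiff ℝ ((⊤ : ℕ∞) : WithTop ℕ∞) φ ∧ HasCompactSupport φ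

/-- `ρ = (1 / 2π) Δ U` in the sense of distributions, for an almost everywhere finite, locally
integrable function `U` with values in the extended reals. -/
def IsDistribLaplacianOver2Pi (ρ : Measure ℂ) (U : ℂ → EReal) : Prop :=
  (∀ᵐ z, U z ≠ ⊥ ∧ U z ≠ ⊤) ∧
  LocallyIntegrable (fun z => (U z).toReal) ∧
  ∀ ψ : ℂ → ℂ, IsTestFunction ψ →
    ∫ z, ψ z ∂ρ = (1 / (2 * Real.pi) : ℂ) * ∫ z, Laplacian.laplacian ψ z * ((U z).toReal : ℂ)

/-- The monic polynomial of degree `n` with roots `x 0, …, x (n - 1)`. -/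
def rootPoly (x : ℕ → ℂ) (n : ℕ) : ℂ[X] :=
  ∏ i ∈ Finset.range n, (X - C (x i))

/-- `(1 / n) ∑ φ(z_i)`, the sum being over the zeros `z_i` of `p`, counted with multiplicity. -/
def rootAverage (φ : ℂ → ℂ) (p : ℂ[X]) (n : ℕ) : ℂ :=
  (1 / n : ℂ) * (p.roots.map φ).sum

end

/-!
The zeros of a polynomial are seen through its logarithm. If `q = ∏ (X - z_i)` has degree `n` and
`φ` is a test function, Green's formula `∫ Δφ(z) log |z - w| dλ(z) = 2π φ(w)` gives
`(1/n) ∑ φ(z_i) = (1/2π) ∫ Δφ · (1/n) log |q|` (`rootAverage_eq_integral_laplacian`). With `q` the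
monic multiple `(1/m) ∑_k p_{n,k}` of the random sum (`meanPoly`), it therefore suffices to show that
`(1/n) log |q|` tends to `U = max_k U_{μ_k}` in `L¹(supp φ)`, in probability.

*Pointwise convergence* (`tendsto_measure_log_meanPoly`). For almost every `z` the functions
`w ↦ log |z - w|` are `μ_k`-integrable, so the law of large numbers gives
`(1/n) log |p_{n,k}(z)| → U_{μ_k}(z)`. The logarithm of a sum of `m` terms is comparable to the
maximum of their logarithms unless the terms cancel, and cancellation requires two of the terms to
have comparable size. If `U_{μ_k}(z) ≠ U_{μ_l}(z)`, the law of large numbers excludes this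
asymptotically, and the second hypothesis on `φ` yields this inequality for almost every `z` of the
support. Under the first hypothesis, `log |p_{n,k}(z)|` is a sum of independent copies of a
nonconstant variable, independent of `p_{n,l}`; such sums do not concentrate on bounded intervals,
because the modulus of their characteristic function is a power of a function which is less than one
outside a null set (`tendsto_measure_abs_sum_sub_sum_le`).

*Square integrability* (`lintegral_sq_log_meanPoly_div_le`). On a disc, `(1/n) log |q|` is bounded
above by a constant since the samples are bounded, and its negative part is at most the average of
the functions `log⁺ (1 / |z - z_i|)`, whose `L²` norms do not depend on the location of the zeros.
This deterministic bound upgrades convergence in probability at almost every point to convergence in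
`L¹` of the product of the sample space and `supp φ` (`tendsto_lintegral_lintegral_of_sq_bounded`).

*The limit measure* (`exists_isProbabilityMeasure_integral_eq`). Each `U_{μ_k}` satisfies the
sub-mean value inequality on circles, hence so does the maximum `U`. Integrated against
`φ ≥ 0` and divided by the square of the radius, the defect in this inequality converges to a
multiple of `∫ Δφ U`, which is therefore nonnegative. This positive functional on test functions is
represented by a measure, which has mass one because `U(z) - log |z|` vanishes at infinity: test it
against dilations of a cutoff. Test functions determine locally finite measures, whence uniqueness.
-/

open scoped Real

/-! ### The logarithmic kernel -/

lemma posLog_inv_sq_mul_le_four {y : ℝ} (hy : 0 < y) : y * Real.posLog y⁻¹ ^ 2 ≤ 4 := by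
  rcases le_or_gt 1 y with h | h
  · have : Real.posLog y⁻¹ = 0 := by
      rw [Real.posLog_eq_zero_iff, abs_of_pos (inv_pos.2 hy)]
      exact inv_le_one_of_one_le₀ h
    simp [this]
  · have h1 : 1 ≤ |y⁻¹| := by
      rw [abs_of_pos (inv_pos.2 hy)]
      exact (one_le_inv₀ hy).2 h.le
    rw [Real.posLog_eq_log h1]
    have h2 : Real.log y⁻¹ ≤ 2 * √(y⁻¹) := by
      have := Real.log_le_sub_one_of_pos (Real.sqrt_pos.2 (inv_pos.2 hy))
      rw [Real.log_sqrt (inv_pos.2 hy).le] at this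
      linarith
    have h3 : 0 ≤ Real.log y⁻¹ := Real.log_nonneg (by rwa [abs_of_pos (inv_pos.2 hy)] at h1)
    have h4 : Real.log y⁻¹ ^ 2 ≤ 4 * y⁻¹ := by
      calc Real.log y⁻¹ ^ 2 ≤ (2 * √(y⁻¹)) ^ 2 := by gcongr
        _ = 4 * y⁻¹ := by rw [mul_pow, Real.sq_sqrt (inv_pos.2 hy).le]; norm_num
    calc y * Real.log y⁻¹ ^ 2 ≤ y * (4 * y⁻¹) := by gcongr
      _ = 4 := by field_simp

lemma measurable_posLog : Measurable Real.posLog := Real.continuous_posLog.measurable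

/-- The negative part of `log ‖z‖` is square integrable over the plane. -/
lemma integrable_sq_posLog_inv_norm :
    Integrable (fun z : ℂ => Real.posLog ‖z‖⁻¹ ^ 2) := by
  rw [integrable_fun_norm_addHaar volume (f := fun y => Real.posLog y⁻¹ ^ 2)]
  have hsub : IntegrableOn (fun y : ℝ => y ^ (Module.finrank ℝ ℂ - 1) • Real.posLog y⁻¹ ^ 2)
      (Set.Ioc 0 1) := by
    refine Measure.integrableOn_of_bounded (M := 4) (by simp) ?_ ?_
    · exact (by
        have := measurable_posLog
        fun_prop : Measurable _).aestronglyMeasurable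
    · filter_upwards [ae_restrict_mem measurableSet_Ioc] with y hy
      have := posLog_inv_sq_mul_le_four hy.1
      have h0 : 0 ≤ y * Real.posLog y⁻¹ ^ 2 := mul_nonneg hy.1.le (sq_nonneg _)
      simpa [Complex.finrank_real_complex, abs_of_pos hy.1] using this
  refine hsub.of_forall_sdiff_eq_zero measurableSet_Ioi ?_
  rintro y ⟨hy0, hy1⟩
  have hy0' : (0 : ℝ) < y := hy0
  have hy1' : 1 < y := by
    by_contra h
    exact hy1 ⟨hy0, not_lt.1 h⟩
  have : Real.posLog y⁻¹ = 0 := by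
    rw [Real.posLog_eq_zero_iff, abs_of_pos (inv_pos.2 hy0')]
    exact inv_le_one_of_one_le₀ hy1'.le
  simp [this]

/-- The negative part of `log ‖z‖` is bounded by `2⁻¹ (1_{‖z‖ ≤ 1} + (log⁻ ‖z‖) ^ 2)`, hence
integrable. -/
lemma integrable_posLog_inv_norm : Integrable (fun z : ℂ => Real.posLog ‖z‖⁻¹) := by
  have h1 : Integrable ((Metric.closedBall (0 : ℂ) 1).indicator fun _ => (1 : ℝ)) :=
    (integrable_indicator_iff measurableSet_closedBall).2
      (integrableOn_const (isCompact_closedBall (0 : ℂ) 1).measure_lt_top.ne)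
  refine (h1.add integrable_sq_posLog_inv_norm).mono'
    (by have := measurable_posLog; fun_prop) (ae_of_all _ fun z => ?_)
  rw [Real.norm_eq_abs, abs_of_nonneg Real.posLog_nonneg]
  by_cases hz : ‖z‖ ≤ 1
  · have : z ∈ Metric.closedBall (0 : ℂ) 1 := by simpa using hz
    simp only [Pi.add_apply, Set.indicator_of_mem this]
    nlinarith [sq_nonneg (Real.posLog ‖z‖⁻¹ - 1), sq_nonneg (Real.posLog ‖z‖⁻¹)]
  · have : Real.posLog ‖z‖⁻¹ = 0 := by
      rw [Real.posLog_eq_zero_iff, abs_of_nonneg (by positivity)]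
      exact inv_le_one_of_one_le₀ (not_le.1 hz).le
    have h0 : z ∉ Metric.closedBall (0 : ℂ) 1 := by simpa using hz
    simp [Set.indicator_of_notMem h0, this]

/-- In polar coordinates the integral of the negative part of `log ‖z‖` is
`2π ∫₀¹ (-s log s) ds = π / 2`. -/
lemma integral_posLog_inv_norm : ∫ z : ℂ, Real.posLog ‖z‖⁻¹ = π / 2 := by
  rw [integral_fun_norm_addHaar volume (fun y => Real.posLog y⁻¹)]
  have hball : volume.real (Metric.ball (0 : ℂ) 1) = π := by
    simp [Measure.real, Complex.volume_ball]
  have hint : ∫ y in Set.Ioi (0 : ℝ), y ^ (Module.finrank ℝ ℂ - 1) • Real.posLog y⁻¹ = 1 / 4 := by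
    have h1 : ∫ y in Set.Ioi (0 : ℝ), y ^ (Module.finrank ℝ ℂ - 1) • Real.posLog y⁻¹
        = ∫ y in Set.Ioc (0 : ℝ) 1, -(y * Real.log y) := by
      symm
      rw [← integral_indicator measurableSet_Ioc, ← integral_indicator measurableSet_Ioi]
      congr 1
      ext y
      by_cases hy : 0 < y
      · by_cases hy1 : y ≤ 1
        · have h1 : 1 ≤ |y⁻¹| := by
            rw [abs_of_pos (inv_pos.2 hy)]
            exact (one_le_inv₀ hy).2 hy1
          rw [Set.indicator_of_mem (show y ∈ Set.Ioc (0 : ℝ) 1 from ⟨hy, hy1⟩),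
            Set.indicator_of_mem (show y ∈ Set.Ioi (0 : ℝ) from hy), Real.posLog_eq_log h1]
          simp [Complex.finrank_real_complex, Real.log_inv]
        · have : Real.posLog y⁻¹ = 0 := by
            rw [Real.posLog_eq_zero_iff, abs_of_pos (inv_pos.2 hy)]
            exact inv_le_one_of_one_le₀ (not_le.1 hy1).le
          rw [Set.indicator_of_notMem (fun h => hy1 h.2),
            Set.indicator_of_mem (show y ∈ Set.Ioi (0 : ℝ) from hy), this]
          simp
      · rw [Set.indicator_of_notMem (fun h => hy h.1),
          Set.indicator_of_notMem (show y ∉ Set.Ioi (0 : ℝ) from hy)]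
    rw [h1, ← intervalIntegral.integral_of_le zero_le_one]
    have hcont : Continuous fun y : ℝ => y ^ 2 / 4 - y * (y * Real.log y) / 2 := by
      have := Real.continuous_mul_log
      fun_prop
    rw [intervalIntegral.integral_eq_sub_of_hasDerivAt_of_le zero_le_one
      (f := fun y : ℝ => y ^ 2 / 4 - y * (y * Real.log y) / 2) hcont.continuousOn]
    · norm_num
    · intro y hy
      have hy0 : y ≠ 0 := hy.1.ne'
      have := (((hasDerivAt_id y).pow 2).div_const 4).sub
        (((hasDerivAt_id y).mul ((hasDerivAt_id y).mul (Real.hasDerivAt_log hy0))).div_const 2)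
      refine this.congr_deriv ?_
      simp
      field_simp
      ring
    · exact (Real.continuous_mul_log.neg).intervalIntegrable _ _
  rw [hball, hint, Complex.finrank_real_complex]
  simp
  ring

lemma abs_log_le_posLog_add (x : ℝ) :
    |Real.log x| = Real.posLog x + Real.posLog x⁻¹ := by
  rw [← Real.half_mul_log_add_log_abs, ← Real.half_mul_log_add_log_abs, Real.log_inv, abs_neg]
  ring

lemma posLog_norm_sub_le {R S : ℝ} {z w : ℂ} (hz : ‖z‖ ≤ R) (hw : ‖w‖ ≤ S) :
    Real.posLog ‖z - w‖ ≤ Real.posLog (R + S) :=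
  Real.posLog_le_posLog (norm_nonneg _) ((norm_sub_le _ _).trans (add_le_add hz hw))

lemma sq_log_norm_sub_le {R S : ℝ} {z w : ℂ} (hz : ‖z‖ ≤ R) (hw : ‖w‖ ≤ S) :
    Real.log ‖z - w‖ ^ 2 ≤ 2 * Real.posLog (R + S) ^ 2 + 2 * Real.posLog ‖z - w‖⁻¹ ^ 2 := by
  rw [← sq_abs, abs_log_le_posLog_add]
  have h1 := posLog_norm_sub_le hz hw
  have h2 : 0 ≤ Real.posLog ‖z - w‖ := Real.posLog_nonneg
  have h3 : Real.posLog ‖z - w‖ ^ 2 ≤ Real.posLog (R + S) ^ 2 := by gcongr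
  nlinarith [sq_nonneg (Real.posLog ‖z - w‖ - Real.posLog ‖z - w‖⁻¹)]

/-- If `g` is bounded, then `log ‖z - g y‖` is square integrable over `{‖z‖ ≤ R}` against
`dz ⊗ μ(dy)`. -/
lemma integrable_sq_log_norm_sub_prod {Y : Type*} [MeasurableSpace Y] {μ : Measure Y}
    [IsFiniteMeasure μ] {g : Y → ℂ} (hg : Measurable g) {S : ℝ} (hμ : ∀ᵐ y ∂μ, ‖g y‖ ≤ S) (R : ℝ) :
    Integrable (fun p : ℂ × Y => Real.log ‖p.1 - g p.2‖ ^ 2)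
      ((volume.restrict (Metric.closedBall (0 : ℂ) R)).prod μ) := by
  have hfin : IsFiniteMeasure (volume.restrict (Metric.closedBall (0 : ℂ) R)) :=
    isFiniteMeasure_restrict.2 (isCompact_closedBall (0 : ℂ) R).measure_lt_top.ne
  have hN : Integrable (fun p : ℂ × Y => Real.posLog ‖p.1 - g p.2‖⁻¹ ^ 2)
      ((volume.restrict (Metric.closedBall (0 : ℂ) R)).prod μ) := by
    have hm : Measurable (fun p : ℂ × Y => Real.posLog ‖p.1 - g p.2‖⁻¹ ^ 2) := by
      have := measurable_posLog; fun_prop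
    refine (integrable_prod_iff' hm.aestronglyMeasurable).2 ⟨ae_of_all _ fun y => ?_, ?_⟩
    · exact (integrable_sq_posLog_inv_norm.comp_sub_right (g y)).integrableOn
    · refine Integrable.mono' (integrable_const (∫ z : ℂ, Real.posLog ‖z‖⁻¹ ^ 2))
        (hm.norm.stronglyMeasurable.integral_prod_left).aestronglyMeasurable
        (ae_of_all _ fun y => ?_)
      rw [Real.norm_eq_abs, abs_of_nonneg (integral_nonneg fun _ => norm_nonneg _)]
      have h1 : ∫ z : ℂ, Real.posLog ‖z - g y‖⁻¹ ^ 2 = ∫ z : ℂ, Real.posLog ‖z‖⁻¹ ^ 2 :=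
        integral_sub_right_eq_self (fun z : ℂ => Real.posLog ‖z‖⁻¹ ^ 2) (g y)
      rw [← h1]
      simp only [norm_pow, sq_abs, Real.norm_eq_abs]
      exact setIntegral_le_integral (integrable_sq_posLog_inv_norm.comp_sub_right (g y))
        (ae_of_all _ fun _ => sq_nonneg _)
  refine Integrable.mono' (((integrable_const (2 * Real.posLog (R + S) ^ 2)).add (hN.const_mul 2)))
    (by fun_prop : Measurable fun p : ℂ × Y => Real.log ‖p.1 - g p.2‖ ^ 2).aestronglyMeasurable ?_
  have h1 : ∀ᵐ p ∂((volume.restrict (Metric.closedBall (0 : ℂ) R)).prod μ), ‖p.1‖ ≤ R := by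
    have : ∀ᵐ z ∂(volume.restrict (Metric.closedBall (0 : ℂ) R)), ‖z‖ ≤ R := by
      filter_upwards [ae_restrict_mem measurableSet_closedBall] with z hz
      simpa using hz
    exact Measure.quasiMeasurePreserving_fst.ae this
  have h2 : ∀ᵐ p ∂((volume.restrict (Metric.closedBall (0 : ℂ) R)).prod μ), ‖g p.2‖ ≤ S :=
    Measure.quasiMeasurePreserving_snd.ae hμ
  filter_upwards [h1, h2] with p hp1 hp2
  rw [Real.norm_eq_abs, abs_of_nonneg (sq_nonneg _)]
  exact sq_log_norm_sub_le hp1 hp2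

lemma locallyIntegrable_log_norm_sub (w : ℂ) :
    LocallyIntegrable fun z : ℂ => Real.log ‖z - w‖ := by
  have hc : Continuous fun z : ℂ => Real.posLog ‖z - w‖ :=
    Real.continuous_posLog.comp (continuous_id.sub continuous_const).norm
  have := hc.locallyIntegrable (μ := volume) |>.sub
    (integrable_posLog_inv_norm.comp_sub_right w).locallyIntegrable
  refine this.congr (ae_of_all _ fun z => ?_)
  simp [Real.posLog_sub_posLog_inv]

/-! ### Circle averages and the Laplacian -/

/-- `∫₀^{2π} (V (z + r e^{iθ}) - V z) dθ`, that is `2π` times the difference between the average of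
`V` over the circle of radius `r` around `z` and its value at `z`. -/
noncomputable def circleDefect (V : ℂ → ℝ) (r : ℝ) (z : ℂ) : ℝ :=
  ∫ θ in Set.Ioc 0 (2 * π), (V (circleMap z r θ) - V z)

lemma circleMap_eq_add_smul (z : ℂ) (r θ : ℝ) : circleMap z r θ = z + r • circleMap 0 1 θ := by
  simp [circleMap]

lemma circleMap_zero_one_eq (θ : ℝ) :
    circleMap 0 1 θ = Real.cos θ • (1 : ℂ) + Real.sin θ • Complex.I := by
  simp [circleMap, Complex.exp_mul_I]

lemma exists_taylor_two {ψ : ℂ → ℝ} (hψ : ContDiff ℝ 2 ψ) (z h : ℂ) :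
    ∃ s ∈ Set.Ioo (0 : ℝ) 1,
      ψ (z + h) = ψ z + fderiv ℝ ψ z h + 1 / 2 * fderiv ℝ (fderiv ℝ ψ) (z + s • h) h h := by
  set g : ℝ → ℝ := fun t => ψ (z + t • h) with hg
  have hline : ∀ t : ℝ, HasDerivAt (fun t : ℝ => z + t • h) h t := fun t => by
    simpa using ((hasDerivAt_id t).smul_const h).const_add z
  have hd1 : ∀ t, HasDerivAt g (fderiv ℝ ψ (z + t • h) h) t := fun t =>
    ((hψ.differentiable (by norm_num)).differentiableAt.hasFDerivAt).comp_hasDerivAt t (hline t)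
  have hD : Differentiable ℝ (fderiv ℝ ψ) :=
    (hψ.fderiv_right (m := 1) (by norm_num)).differentiable (by norm_num)
  have hd2 : ∀ t, HasDerivAt (fun t : ℝ => fderiv ℝ ψ (z + t • h) h)
      (fderiv ℝ (fderiv ℝ ψ) (z + t • h) h h) t := fun t => by
    have := (hD.differentiableAt.hasFDerivAt (x := z + t • h)).comp_hasDerivAt t (hline t)
    exact this.clm_apply (hasDerivAt_const t h) |>.congr_deriv (by simp)
  have hderiv : deriv g = fun t : ℝ => fderiv ℝ ψ (z + t • h) h := funext fun t => (hd1 t).deriv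
  have hgc : ContDiff ℝ 2 g := by
    have : ContDiff ℝ 2 fun t : ℝ => z + t • h := by fun_prop
    exact hψ.comp this
  obtain ⟨s, hs, hs'⟩ := taylor_mean_remainder_lagrange_iteratedDeriv (f := g) (x := 1) (x₀ := 0)
    (n := 1) zero_ne_one (by norm_num; exact hgc.contDiffOn)
  have hu : Set.uIcc (0 : ℝ) 1 = Set.Icc 0 1 := Set.uIcc_of_le zero_le_one
  have huo : Set.uIoo (0 : ℝ) 1 = Set.Ioo 0 1 := Set.uIoo_of_le zero_le_one
  refine ⟨s, huo ▸ hs, ?_⟩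
  have hdw : derivWithin g (Set.Icc 0 1) 0 = fderiv ℝ ψ z h := by
    rw [(hd1 0).hasDerivWithinAt.derivWithin (uniqueDiffOn_Icc zero_lt_one 0 (by simp))]
    simp
  rw [taylorWithinEval_succ, taylor_within_zero_eval, hu, iteratedDerivWithin_one, hdw,
    iteratedDeriv_succ, iteratedDeriv_one, hderiv, (hd2 s).deriv] at hs'
  simp only [hg, one_smul, zero_smul, add_zero, sub_zero, one_mul, one_pow, mul_one, zero_add,
    Nat.factorial, Nat.cast_one, inv_one, smul_eq_mul, pow_one, Nat.reduceAdd, CharP.cast_eq_zero] at hs'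
  linarith

lemma integral_cos_Ioc : ∫ θ in Set.Ioc 0 (2 * π), Real.cos θ = 0 := by
  rw [← intervalIntegral.integral_of_le Real.two_pi_pos.le]
  simp

lemma integral_sin_Ioc : ∫ θ in Set.Ioc 0 (2 * π), Real.sin θ = 0 := by
  rw [← intervalIntegral.integral_of_le Real.two_pi_pos.le]
  simp

lemma integral_linear_circleMap (A : ℂ →L[ℝ] ℝ) :
    ∫ θ in Set.Ioc 0 (2 * π), A (circleMap 0 1 θ) = 0 := by
  have h1 : IntegrableOn Real.cos (Set.Ioc 0 (2 * π)) :=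
    (Real.continuous_cos.integrableOn_Icc).mono_set Set.Ioc_subset_Icc_self
  have h2 : IntegrableOn Real.sin (Set.Ioc 0 (2 * π)) :=
    (Real.continuous_sin.integrableOn_Icc).mono_set Set.Ioc_subset_Icc_self
  simp_rw [circleMap_zero_one_eq, map_add, map_smul, smul_eq_mul]
  rw [integral_add (h1.mul_const _) (h2.mul_const _), integral_mul_const, integral_mul_const,
    integral_cos_Ioc, integral_sin_Ioc]
  simp

lemma integral_bilinear_circleMap (B : ℂ →L[ℝ] ℂ →L[ℝ] ℝ) :
    ∫ θ in Set.Ioc 0 (2 * π), B (circleMap 0 1 θ) (circleMap 0 1 θ)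
      = π * (B 1 1 + B Complex.I Complex.I) := by
  have hint : ∀ f : ℝ → ℝ, Continuous f → IntervalIntegrable f volume 0 (2 * π) := fun f hf =>
    hf.intervalIntegrable _ _
  have h : ∀ θ, B (circleMap 0 1 θ) (circleMap 0 1 θ) =
      Real.cos θ ^ 2 * B 1 1 + (Real.sin θ * Real.cos θ * (B 1 Complex.I + B Complex.I 1)
        + Real.sin θ ^ 2 * B Complex.I Complex.I) := fun θ => by
    simp only [circleMap_zero_one_eq, map_add, map_smul, smul_eq_mul,
      _root_.add_apply, _root_.smul_apply]
    ring
  simp_rw [h]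
  rw [← intervalIntegral.integral_of_le Real.two_pi_pos.le,
    intervalIntegral.integral_add (hint _ (by fun_prop)) (hint _ (by fun_prop)),
    intervalIntegral.integral_add (hint _ (by fun_prop)) (hint _ (by fun_prop)),
    intervalIntegral.integral_mul_const, intervalIntegral.integral_mul_const,
    intervalIntegral.integral_mul_const, integral_cos_sq, integral_sin_sq,
    integral_sin_mul_cos₁]
  simp
  ring

lemma laplacian_eq_fderiv_fderiv (ψ : ℂ → ℝ) (z : ℂ) :
    Laplacian.laplacian ψ z = fderiv ℝ (fderiv ℝ ψ) z 1 1
      + fderiv ℝ (fderiv ℝ ψ) z Complex.I Complex.I := by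
  rw [InnerProductSpace.laplacian_eq_iteratedFDeriv_complexPlane]
  simp [iteratedFDeriv_two_apply]

lemma norm_circleMap_zero_one (θ : ℝ) : ‖circleMap 0 1 θ‖ = 1 := by simp

lemma continuous_circleMap_uncurry (r : ℝ) : Continuous fun p : ℂ × ℝ => circleMap p.1 r p.2 := by
  unfold circleMap
  fun_prop

/-- The circle defect of a smooth function as the integral of a second order Taylor remainder: the
first order term integrates to zero over the circle. -/
lemma circleDefect_eq_integral_sub {ψ : ℂ → ℝ} (hψ : ContDiff ℝ 2 ψ) (r : ℝ) (z : ℂ) :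
    circleDefect ψ r z = ∫ θ in Set.Ioc 0 (2 * π),
      (ψ (z + r • circleMap 0 1 θ) - ψ z - fderiv ℝ ψ z (r • circleMap 0 1 θ)) := by
  have hc : Continuous fun θ : ℝ => ψ (z + r • circleMap 0 1 θ) - ψ z := by
    have := hψ.continuous
    have := continuous_circleMap 0 1
    fun_prop
  have hc2 : Continuous fun θ : ℝ => fderiv ℝ ψ z (r • circleMap 0 1 θ) := by
    have := continuous_circleMap 0 1
    fun_prop
  rw [integral_sub (hc.integrableOn_Icc.mono_set Set.Ioc_subset_Icc_self)
    (hc2.integrableOn_Icc.mono_set Set.Ioc_subset_Icc_self)]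
  simp_rw [map_smul]
  rw [integral_smul, integral_linear_circleMap, smul_zero, sub_zero]
  simp_rw [circleDefect, circleMap_eq_add_smul z]

lemma abs_taylor_remainder_le {ψ : ℂ → ℝ} (hψ : ContDiff ℝ 2 ψ) {M : ℝ}
    (hM : ∀ z, ‖iteratedFDeriv ℝ 2 ψ z‖ ≤ M) (r : ℝ) (z : ℂ) (θ : ℝ) :
    |ψ (z + r • circleMap 0 1 θ) - ψ z - fderiv ℝ ψ z (r • circleMap 0 1 θ)| ≤ M / 2 * r ^ 2 := by
  obtain ⟨s, -, hs⟩ := exists_taylor_two hψ z (r • circleMap 0 1 θ)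
  have hn : ‖r • circleMap 0 1 θ‖ = |r| := by simp
  have h1 : ‖fderiv ℝ (fderiv ℝ ψ) (z + s • r • circleMap 0 1 θ) (r • circleMap 0 1 θ)
      (r • circleMap 0 1 θ)‖ ≤ M * r ^ 2 := by
    have h2 := (iteratedFDeriv ℝ 2 ψ (z + s • r • circleMap 0 1 θ)).le_opNorm
      ![r • circleMap 0 1 θ, r • circleMap 0 1 θ]
    rw [iteratedFDeriv_two_apply, Fin.prod_univ_two] at h2
    simp only [Matrix.cons_val_zero, Matrix.cons_val_one, hn] at h2
    refine h2.trans ?_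
    rw [← sq, sq_abs]
    gcongr
    exact hM _
  rw [hs, show ∀ a b c : ℝ, a + b + 1 / 2 * c - a - b = 1 / 2 * c by intros; ring, abs_mul]
  rw [Real.norm_eq_abs] at h1
  rw [abs_of_pos (by norm_num : (0 : ℝ) < 1 / 2)]
  linarith

lemma abs_circleDefect_le {ψ : ℂ → ℝ} (hψ : ContDiff ℝ 2 ψ) {M : ℝ}
    (hM : ∀ z, ‖iteratedFDeriv ℝ 2 ψ z‖ ≤ M) (r : ℝ) (z : ℂ) :
    |circleDefect ψ r z| ≤ M * π * r ^ 2 := by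
  rw [circleDefect_eq_integral_sub hψ]
  have := norm_setIntegral_le_of_norm_le_const (μ := volume) (s := Set.Ioc 0 (2 * π))
    (f := fun θ => ψ (z + r • circleMap 0 1 θ) - ψ z - fderiv ℝ ψ z (r • circleMap 0 1 θ))
    (C := M / 2 * r ^ 2) (by rw [Real.volume_Ioc]; exact ENNReal.ofReal_lt_top)
    (fun θ _ => abs_taylor_remainder_le hψ hM r z θ)
  rw [Real.norm_eq_abs] at this
  refine this.trans_eq ?_
  simp [Measure.real, Real.pi_pos.le]
  ring

/-- The second order Taylor expansion of circle averages. -/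
lemma tendsto_circleDefect_div_sq {ψ : ℂ → ℝ} (hψ : ContDiff ℝ 2 ψ) {M : ℝ}
    (hM : ∀ z, ‖iteratedFDeriv ℝ 2 ψ z‖ ≤ M) (z : ℂ) :
    Tendsto (fun r : ℝ => circleDefect ψ r z / r ^ 2) (𝓝[≠] 0)
      (𝓝 (π / 2 * Laplacian.laplacian ψ z)) := by
  have hlim : π / 2 * Laplacian.laplacian ψ z = ∫ θ in Set.Ioc 0 (2 * π),
      (1 / 2 * fderiv ℝ (fderiv ℝ ψ) z (circleMap 0 1 θ) (circleMap 0 1 θ)) := by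
    rw [integral_const_mul, integral_bilinear_circleMap, laplacian_eq_fderiv_fderiv]
    ring
  simp_rw [circleDefect_eq_integral_sub hψ, hlim, ← integral_div]
  have hcirc := continuous_circleMap 0 1
  have hψc := hψ.continuous
  refine tendsto_integral_filter_of_dominated_convergence (fun _ => M / 2) ?_ ?_
    (integrable_const _) ?_
  · refine Eventually.of_forall fun r => Continuous.aestronglyMeasurable ?_
    fun_prop
  · filter_upwards [self_mem_nhdsWithin] with r hr
    refine ae_of_all _ fun θ => ?_
    have hr2 : 0 < r ^ 2 := by
      have : r ≠ 0 := hr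
      positivity
    rw [Real.norm_eq_abs, abs_div, abs_of_pos hr2, div_le_iff₀ hr2]
    exact abs_taylor_remainder_le hψ hM r z θ
  · refine ae_of_all _ fun θ => ?_
    choose s hs hs' using fun r : ℝ => exists_taylor_two hψ z (r • circleMap 0 1 θ)
    have hpt : Tendsto (fun r : ℝ => z + s r • r • circleMap 0 1 θ) (𝓝[≠] 0) (𝓝 z) := by
      have h0 : Tendsto (fun r : ℝ => s r • r • circleMap 0 1 θ) (𝓝[≠] 0) (𝓝 0) := by
        refine squeeze_zero_norm (a := fun r : ℝ => |r|) (fun r => ?_) ?_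
        · rw [norm_smul, norm_smul, norm_circleMap_zero_one, mul_one, Real.norm_eq_abs,
            Real.norm_eq_abs, abs_of_pos (hs r).1]
          exact mul_le_of_le_one_left (abs_nonneg _) (hs r).2.le
        · have : Tendsto (fun r : ℝ => |r|) (𝓝 0) (𝓝 |0|) := continuous_abs.tendsto 0
          rw [abs_zero] at this
          exact this.mono_left nhdsWithin_le_nhds
      simpa using h0.const_add z
    have hcD : Continuous (fderiv ℝ (fderiv ℝ ψ)) :=
      (hψ.fderiv_right (m := 1) (by norm_num)).continuous_fderiv (by norm_num)
    have h1 : Tendsto (fun r : ℝ => 1 / 2 * fderiv ℝ (fderiv ℝ ψ) (z + s r • r • circleMap 0 1 θ)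
        (circleMap 0 1 θ) (circleMap 0 1 θ)) (𝓝[≠] 0)
        (𝓝 (1 / 2 * fderiv ℝ (fderiv ℝ ψ) z (circleMap 0 1 θ) (circleMap 0 1 θ))) := by
      have hcc : Continuous fun x : ℂ => 1 / 2 * fderiv ℝ (fderiv ℝ ψ) x
        (circleMap 0 1 θ) (circleMap 0 1 θ) := by fun_prop
      exact (hcc.tendsto z).comp hpt
    refine h1.congr' ?_
    filter_upwards [self_mem_nhdsWithin] with r hr
    have hr0 : r ≠ 0 := hr
    rw [hs' r]
    simp only [map_smul, _root_.smul_apply, smul_eq_mul]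
    field_simp
    ring

lemma circleDefect_eq_zero_of_notMem {ψ : ℂ → ℝ} {r : ℝ} (hr : |r| ≤ 1) {z : ℂ}
    (hz : z ∉ Metric.cthickening 1 (tsupport ψ)) : circleDefect ψ r z = 0 := by
  have h0 : ψ z = 0 := image_eq_zero_of_notMem_tsupport fun h =>
    hz (Metric.self_subset_cthickening _ h)
  have h1 : ∀ θ, ψ (circleMap z r θ) = 0 := fun θ => image_eq_zero_of_notMem_tsupport fun h => by
    refine hz (Metric.mem_cthickening_of_dist_le z _ 1 _ h ?_)
    rw [dist_comm, dist_eq_norm, circleMap_sub_center, norm_circleMap_zero]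
    exact hr
  simp [circleDefect, h0, h1]

lemma continuous_circleDefect {ψ : ℂ → ℝ} (hψ : Continuous ψ) (r : ℝ) :
    Continuous (circleDefect ψ r) := by
  unfold circleDefect
  simp_rw [← intervalIntegral.integral_of_le Real.two_pi_pos.le]
  refine intervalIntegral.continuous_parametric_intervalIntegral_of_continuous' ?_ _ _
  have := continuous_circleMap_uncurry r
  fun_prop

/-- The distributional Laplacian of a locally integrable `V` against a test function, as a limit of
circle averages of the test function. -/
lemma tendsto_integral_circleDefect_mul {ψ : ℂ → ℝ} (hψ : ContDiff ℝ 2 ψ)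
    (hc : HasCompactSupport ψ) {V : ℂ → ℝ} (hV : LocallyIntegrable V) :
    Tendsto (fun r : ℝ => (∫ z, circleDefect ψ r z * V z) / r ^ 2) (𝓝[≠] 0)
      (𝓝 (π / 2 * ∫ z, Laplacian.laplacian ψ z * V z)) := by
  obtain ⟨M, hM⟩ := (hc.iteratedFDeriv (𝕜 := ℝ) 2).exists_bound_of_continuous
    (hψ.continuous_iteratedFDeriv (by norm_num))
  set K := Metric.cthickening 1 (tsupport ψ) with hK
  have hKc : IsCompact K := hc.isCompact.cthickening
  simp_rw [← integral_div, ← integral_const_mul]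
  refine tendsto_integral_filter_of_dominated_convergence
    (K.indicator fun z => M * π * |V z|) ?_ ?_ ?_ ?_
  · refine Eventually.of_forall fun r => ?_
    simp_rw [div_eq_mul_inv]
    refine AEStronglyMeasurable.mul_const ?_ _
    exact (continuous_circleDefect hψ.continuous r).aestronglyMeasurable.mul hV.aestronglyMeasurable
  · have hev : ∀ᶠ r : ℝ in 𝓝[≠] 0, |r| ≤ 1 := by
      refine nhdsWithin_le_nhds ?_
      filter_upwards [Metric.ball_mem_nhds (0 : ℝ) one_pos] with r hr
      simpa using (Metric.mem_ball.1 hr).le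
    filter_upwards [hev, self_mem_nhdsWithin] with r hr hr0
    have hr2 : 0 < r ^ 2 := by
      have : r ≠ 0 := hr0
      positivity
    refine ae_of_all _ fun z => ?_
    by_cases hz : z ∈ K
    · rw [Set.indicator_of_mem hz, Real.norm_eq_abs, abs_div, abs_mul, abs_of_pos hr2,
        div_le_iff₀ hr2]
      calc |circleDefect ψ r z| * |V z| ≤ (M * π * r ^ 2) * |V z| := by
            gcongr; exact abs_circleDefect_le hψ hM r z
        _ = _ := by ring
    · rw [Set.indicator_of_notMem hz, circleDefect_eq_zero_of_notMem hr hz]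
      simp
  · rw [integrable_indicator_iff hKc.isClosed.measurableSet]
    exact ((hV.integrableOn_isCompact hKc).abs).const_mul _
  · refine ae_of_all _ fun z => ?_
    have := (tendsto_circleDefect_div_sq hψ hM z).mul_const (V z)
    rw [← mul_assoc]
    refine this.congr fun r => ?_
    ring

/-- Averaging over circles is symmetric. -/
lemma integral_circleDefect_mul_comm {ψ : ℂ → ℝ} (hψ : Continuous ψ) (hc : HasCompactSupport ψ)
    {V : ℂ → ℝ} (hV : LocallyIntegrable V) (r : ℝ) :
    ∫ z, circleDefect ψ (-r) z * V z = ∫ z, ψ z * circleDefect V r z := by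
  set τ : Measure ℝ := volume.restrict (Set.Ioc 0 (2 * π)) with hτ
  set K := Metric.cthickening |r| (tsupport ψ) with hK
  have hKc : IsCompact K := hc.isCompact.cthickening
  obtain ⟨C, hC⟩ := hc.exists_bound_of_continuous hψ
  have hcont : Continuous fun p : ℝ × ℂ => circleMap p.2 (-r) p.1 :=
    (continuous_circleMap_uncurry (-r)).comp continuous_swap
  -- the function `(θ, z) ↦ ψ (z - r e^{iθ}) V z` is integrable
  have hF : Integrable (fun p : ℝ × ℂ => ψ (circleMap p.2 (-r) p.1) * V p.2) (τ.prod volume) := by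
    have hi : Integrable (K.indicator fun z => C * |V z|) :=
      (integrable_indicator_iff hKc.isClosed.measurableSet).2
        (((hV.integrableOn_isCompact hKc).abs).const_mul _)
    refine (hi.comp_snd τ).mono'
      ((hψ.comp hcont).aestronglyMeasurable.mul hV.aestronglyMeasurable.comp_snd)
      (ae_of_all _ fun p => ?_)
    by_cases hp : p.2 ∈ K
    · rw [Set.indicator_of_mem hp, norm_mul, Real.norm_eq_abs (V _)]
      gcongr
      exact hC _
    · have : ψ (circleMap p.2 (-r) p.1) = 0 := image_eq_zero_of_notMem_tsupport fun h => by
        refine hp (Metric.mem_cthickening_of_dist_le p.2 _ _ _ h ?_)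
        rw [dist_comm, dist_eq_norm, circleMap_sub_center, norm_circleMap_zero, abs_neg]
      rw [Set.indicator_of_notMem hp, this]
      simp
  -- hence so is its image under the measure preserving shear `(θ, z) ↦ (θ, z + r e^{iθ})`
  have hT : MeasurePreserving (fun p : ℝ × ℂ => (p.1, p.2 + circleMap 0 r p.1))
      (τ.prod volume) (τ.prod volume) := by
    refine (MeasurePreserving.id τ).skew_product (g := fun θ z => z + circleMap 0 r θ) ?_
      (ae_of_all _ fun θ => map_add_right_eq_self volume _)
    have := continuous_circleMap 0 r
    exact (by fun_prop : Continuous fun p : ℝ × ℂ => p.2 + circleMap 0 r p.1).measurable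
  have hback : ∀ θ z, circleMap (circleMap z r θ) (-r) θ = z := fun θ z => by
    simp [circleMap]
  have hfwd : ∀ θ z, z + circleMap 0 r θ = circleMap z r θ := fun θ z => by
    simp [circleMap]
  have hG : Integrable (fun p : ℝ × ℂ => ψ p.2 * V (circleMap p.2 r p.1)) (τ.prod volume) := by
    have := hT.integrable_comp_of_integrable hF
    refine this.congr (ae_of_all _ fun p => ?_)
    simp only [Function.comp_apply, hfwd, hback]
  have hψV : Integrable fun z => ψ z * V z := by
    have := hV.integrable_smul_left_of_hasCompactSupport hψ hc
    simpa using this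
  have h0 : Integrable (fun p : ℝ × ℂ => ψ p.2 * V p.2) (τ.prod volume) := hψV.comp_snd τ
  calc ∫ z : ℂ, circleDefect ψ (-r) z * V z
      = ∫ z : ℂ, ∫ θ, (ψ (circleMap z (-r) θ) * V z - ψ z * V z) ∂τ := by
        simp_rw [circleDefect, ← integral_mul_const, sub_mul]
        rfl
    _ = ∫ θ, (∫ z : ℂ, (ψ (circleMap z (-r) θ) * V z - ψ z * V z)) ∂τ :=
        (integral_integral_swap (f := fun θ z => ψ (circleMap z (-r) θ) * V z - ψ z * V z)
          (hF.sub h0)).symm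
    _ = ∫ θ, (∫ z : ℂ, (ψ z * V (circleMap z r θ) - ψ z * V z)) ∂τ := by
        refine integral_congr_ae ?_
        filter_upwards [hF.prod_right_ae, hG.prod_right_ae] with θ h1 h2
        rw [integral_sub h1 hψV, integral_sub h2 hψV]
        congr 1
        rw [← integral_add_right_eq_self (fun z => ψ (circleMap z (-r) θ) * V z)
          (circleMap 0 r θ)]
        simp only [hfwd, hback]
    _ = ∫ z : ℂ, ∫ θ, (ψ z * V (circleMap z r θ) - ψ z * V z) ∂τ :=
        integral_integral_swap (f := fun θ z => ψ z * V (circleMap z r θ) - ψ z * V z) (hG.sub h0)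
    _ = ∫ z : ℂ, ψ z * circleDefect V r z := by
        simp_rw [circleDefect, ← integral_const_mul, mul_sub]
        rfl

/-- The distributional Laplacian of a locally integrable function is the limit of its rescaled
circle defects. -/
theorem tendsto_integral_mul_circleDefect {ψ : ℂ → ℝ} (hψ : ContDiff ℝ 2 ψ)
    (hc : HasCompactSupport ψ) {V : ℂ → ℝ} (hV : LocallyIntegrable V) :
    Tendsto (fun r : ℝ => (∫ z : ℂ, ψ z * circleDefect V r z) / r ^ 2) (𝓝[>] 0)
      (𝓝 (π / 2 * ∫ z : ℂ, Laplacian.laplacian ψ z * V z)) := by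
  have h1 : Tendsto (fun r : ℝ => -r) (𝓝[>] 0) (𝓝[≠] 0) := by
    refine tendsto_nhdsWithin_iff.2 ⟨?_, ?_⟩
    · have : Tendsto (fun r : ℝ => -r) (𝓝 0) (𝓝 (-0)) := tendsto_id.neg
      rw [neg_zero] at this
      exact this.mono_left nhdsWithin_le_nhds
    · filter_upwards [self_mem_nhdsWithin] with r hr
      have : (0 : ℝ) < r := hr
      simp [this.ne']
  refine ((tendsto_integral_circleDefect_mul hψ hc hV).comp h1).congr fun r => ?_
  simp [integral_circleDefect_mul_comm hψ.continuous hc hV]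

/-! ### The fundamental solution of the Laplacian -/

lemma integrableOn_log_norm_circleMap_sub (z w : ℂ) (r : ℝ) :
    IntegrableOn (fun θ => Real.log ‖circleMap z r θ - w‖) (Set.Ioc 0 (2 * π)) := by
  have := circleIntegrable_log_norm_sub_const (a := w) (c := z) r
  rw [CircleIntegrable, intervalIntegrable_iff, Set.uIoc_of_le Real.two_pi_pos.le] at this
  exact this

lemma circleDefect_log_norm_sub {z w : ℂ} (hzw : z ≠ w) {r : ℝ} (hr : 0 < r) :
    circleDefect (fun z => Real.log ‖z - w‖) r z = 2 * π * Real.posLog ‖r⁻¹ • (z - w)‖⁻¹ := by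
  have havg := circleAverage_log_norm_sub_const_eq_log_radius_add_posLog (a := w) (c := z) hr.ne'
  rw [Real.circleAverage_def, intervalIntegral.integral_of_le Real.two_pi_pos.le, smul_eq_mul,
    inv_mul_eq_iff_eq_mul₀ Real.two_pi_pos.ne'] at havg
  have hn : 0 < ‖z - w‖ := norm_pos_iff.2 (sub_ne_zero.2 hzw)
  have hlog := Real.posLog_sub_posLog_inv (x := r⁻¹ * ‖z - w‖)
  rw [Real.log_mul (inv_ne_zero hr.ne') hn.ne', Real.log_inv] at hlog
  unfold circleDefect
  rw [integral_sub (integrableOn_log_norm_circleMap_sub z w r) (integrable_const _), havg,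
    norm_smul, Real.norm_eq_abs, abs_of_pos (inv_pos.2 hr)]
  simp only [integral_const, smul_eq_mul, measureReal_restrict_apply_univ, Real.volume_real_Ioc,
    sub_zero, max_eq_left Real.two_pi_pos.le]
  linear_combination 2 * π * hlog

/-- `(1 / 2π) log ‖z - w‖` is a fundamental solution of the Laplacian: the rescaled circle defects
of `log ‖z - w‖` are a multiple of an approximate identity at
`w`. -/
theorem integral_laplacian_mul_log_norm_sub {ψ : ℂ → ℝ} (hψ : ContDiff ℝ 2 ψ)
    (hc : HasCompactSupport ψ) (w : ℂ) :
    ∫ z, Laplacian.laplacian ψ z * Real.log ‖z - w‖ = 2 * π * ψ w := by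
  have h1 := tendsto_integral_mul_circleDefect hψ hc (locallyIntegrable_log_norm_sub w)
  obtain ⟨C, hC⟩ := hc.exists_bound_of_continuous hψ.continuous
  have h2 : Tendsto (fun r : ℝ => ∫ u : ℂ, 2 * π * (ψ (w + r • u) * Real.posLog ‖u‖⁻¹)) (𝓝[>] 0)
      (𝓝 (∫ u : ℂ, 2 * π * (ψ w * Real.posLog ‖u‖⁻¹))) := by
    have hψc := hψ.continuous
    have hm := measurable_posLog
    refine tendsto_integral_filter_of_dominated_convergence
      (fun u => 2 * π * (C * Real.posLog ‖u‖⁻¹)) ?_ ?_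
      ((integrable_posLog_inv_norm.const_mul C).const_mul _) ?_
    · exact Eventually.of_forall fun r => (by fun_prop : Measurable _).aestronglyMeasurable
    · refine Eventually.of_forall fun r => ae_of_all _ fun u => ?_
      rw [norm_mul (2 * π), norm_mul (ψ _), Real.norm_eq_abs (2 * π), Real.norm_eq_abs (Real.posLog _),
        abs_of_pos Real.two_pi_pos, abs_of_nonneg Real.posLog_nonneg]
      have := Real.posLog_nonneg (x := ‖u‖⁻¹)
      have := hC (w + r • u)
      gcongr
    · refine ae_of_all _ fun u => ?_
      have hcc : Continuous fun r : ℝ => 2 * π * (ψ (w + r • u) * Real.posLog ‖u‖⁻¹) := by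
        fun_prop
      have := hcc.tendsto 0
      simp only [zero_smul, add_zero] at this
      exact this.mono_left nhdsWithin_le_nhds
  have h3 : (fun r : ℝ => (∫ z, ψ z * circleDefect (fun z => Real.log ‖z - w‖) r z) / r ^ 2)
      =ᶠ[𝓝[>] 0] fun r : ℝ => ∫ u : ℂ, 2 * π * (ψ (w + r • u) * Real.posLog ‖u‖⁻¹) := by
    filter_upwards [self_mem_nhdsWithin] with r hr
    have hr0 : 0 < r := hr
    have hae : ∀ᵐ z : ℂ, z ≠ w := by simp [ae_iff]
    have e1 : ∫ z, ψ z * circleDefect (fun z => Real.log ‖z - w‖) r z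
        = ∫ z, 2 * π * (ψ z * Real.posLog ‖r⁻¹ • (z - w)‖⁻¹) := by
      refine integral_congr_ae ?_
      filter_upwards [hae] with z hz
      rw [circleDefect_log_norm_sub hz hr0]
      ring
    have e2 := Measure.integral_comp_smul_of_nonneg volume
      (fun x : ℂ => 2 * π * (ψ (w + x) * Real.posLog ‖r⁻¹ • x‖⁻¹)) r (hR := hr0.le)
    rw [e1, ← integral_add_right_eq_self _ w]
    simp only [add_sub_cancel_right, inv_smul_smul₀ hr0.ne', Complex.finrank_real_complex,
      smul_eq_mul] at e2 ⊢
    rw [e2, div_eq_inv_mul]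
    simp only [add_comm]
  have h4 := tendsto_nhds_unique (h1.congr' h3) h2
  rw [integral_const_mul, integral_const_mul, integral_posLog_inv_norm] at h4
  have hpi := Real.pi_pos
  have : π / 2 * (∫ z, Laplacian.laplacian ψ z * Real.log ‖z - w‖) = π / 2 * (2 * π * ψ w) := by
    rw [h4]; ring
  exact mul_left_cancel₀ (by positivity) this

/-! ### Logarithmic potentials -/

/-- The logarithmic potential as a real valued Bochner integral; it agrees with `logPotential`
almost everywhere. -/
noncomputable def realPotential (μ : Measure ℂ) (z : ℂ) : ℝ := ∫ w, Real.log ‖z - w‖ ∂μ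

/-- The pointwise maximum of the real valued potentials. -/
noncomputable def realMaxPotential {m : ℕ} (μ : Fin m → Measure ℂ) (z : ℂ) : ℝ :=
  ⨆ k, realPotential (μ k) z

lemma exists_ae_norm_le {μ : Measure ℂ} (h : IsCompact μ.support) :
    ∃ S : ℝ, 0 < S ∧ ∀ᵐ w ∂μ, ‖w‖ ≤ S := by
  obtain ⟨S, hS, hsub⟩ := h.isBounded.subset_closedBall_lt 0 0
  refine ⟨S, hS, ?_⟩
  filter_upwards [Measure.support_mem_ae (μ := μ)] with w hw
  simpa using hsub hw

lemma measurable_realPotential (μ : Measure ℂ) [SFinite μ] : Measurable (realPotential μ) := by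
  have : Measurable fun p : ℂ × ℂ => Real.log ‖p.1 - p.2‖ := by fun_prop
  exact (this.stronglyMeasurable.integral_prod_right (ν := μ)).measurable

lemma measurable_realMaxPotential {m : ℕ} (μ : Fin m → Measure ℂ) [∀ k, SFinite (μ k)] :
    Measurable (realMaxPotential μ) :=
  Measurable.iSup fun k => measurable_realPotential (μ k)

lemma ae_of_forall_ae_closedBall {p : ℂ → Prop}
    (h : ∀ R : ℝ, ∀ᵐ z ∂(volume.restrict (Metric.closedBall (0 : ℂ) R)), p z) : ∀ᵐ z, p z := by
  have := (ae_restrict_iUnion_iff (μ := volume) (fun n : ℕ => Metric.closedBall (0 : ℂ) n) p).2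
    fun n => h n
  rwa [Metric.iUnion_closedBall_nat, Measure.restrict_univ] at this

/-- If `g` is bounded, then `log ‖z - g y‖` is square integrable in `y` for almost every `z`. -/
lemma ae_memLp_log_norm_sub {Y : Type*} [MeasurableSpace Y] {μ : Measure Y}
    [IsFiniteMeasure μ] {g : Y → ℂ} (hg : Measurable g) {S : ℝ} (hμ : ∀ᵐ y ∂μ, ‖g y‖ ≤ S) :
    ∀ᵐ z : ℂ, MemLp (fun y => Real.log ‖z - g y‖) 2 μ := by
  refine ae_of_forall_ae_closedBall fun R => ?_
  filter_upwards [(integrable_sq_log_norm_sub_prod hg hμ R).prod_right_ae] with z hz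
  exact (memLp_two_iff_integrable_sq
    (by fun_prop : Measurable fun y => Real.log ‖z - g y‖).aestronglyMeasurable).2 hz

lemma ae_integrable_log_norm_sub {μ : Measure ℂ} [IsFiniteMeasure μ] {S : ℝ}
    (hμ : ∀ᵐ w ∂μ, ‖w‖ ≤ S) : ∀ᵐ z : ℂ, Integrable (fun w => Real.log ‖z - w‖) μ := by
  filter_upwards [ae_memLp_log_norm_sub measurable_id hμ] with z hz
  exact hz.integrable (by norm_num)

lemma ae_ae_ne (μ : Measure ℂ) [SFinite μ] : ∀ᵐ z : ℂ, ∀ᵐ w ∂μ, z ≠ w := by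
  rw [Measure.ae_ae_comm (p := fun z w : ℂ => z ≠ w)
    (measurableSet_eq_fun measurable_fst measurable_snd).compl]
  exact ae_of_all _ fun w => by simp [ae_iff]

lemma logPotential_eq_realPotential {μ : Measure ℂ} {z : ℂ}
    (hint : Integrable (fun w => Real.log ‖z - w‖) μ) (hne : ∀ᵐ w ∂μ, z ≠ w) :
    logPotential μ z = (realPotential μ z : EReal) := by
  have hlog : ∀ᵐ w ∂μ, ENNReal.log ‖z - w‖ₑ = ((Real.log ‖z - w‖ : ℝ) : EReal) := by
    filter_upwards [hne] with w hw
    rw [← ofReal_norm, ENNReal.log_ofReal_of_pos (norm_pos_iff.2 (sub_ne_zero.2 hw))]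
  have h1 : ∫⁻ w, (ENNReal.log ‖z - w‖ₑ).toENNReal ∂μ
      = ∫⁻ w, ENNReal.ofReal (Real.log ‖z - w‖) ∂μ := by
    refine lintegral_congr_ae ?_
    filter_upwards [hlog] with w hw
    rw [hw, EReal.real_coe_toENNReal]
  have h2 : ∫⁻ w, (-ENNReal.log ‖z - w‖ₑ).toENNReal ∂μ
      = ∫⁻ w, ENNReal.ofReal (-Real.log ‖z - w‖) ∂μ := by
    refine lintegral_congr_ae ?_
    filter_upwards [hlog] with w hw
    rw [hw, ← EReal.coe_neg, EReal.real_coe_toENNReal]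
  have f1 := hint.lintegral_lt_top.ne
  have f2 := hint.neg.lintegral_lt_top.ne
  simp only [Pi.neg_apply] at f2
  rw [logPotential, h1, h2, realPotential,
    integral_eq_lintegral_pos_part_sub_lintegral_neg_part hint, EReal.coe_sub,
    EReal.coe_ennreal_toReal f1, EReal.coe_ennreal_toReal f2]

lemma ae_logPotential_eq {μ : Measure ℂ} [IsFiniteMeasure μ] (h : IsCompact μ.support) :
    ∀ᵐ z, logPotential μ z = (realPotential μ z : EReal) := by
  obtain ⟨S, -, hS⟩ := exists_ae_norm_le h
  filter_upwards [ae_integrable_log_norm_sub hS, ae_ae_ne μ] with z h1 h2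
  exact logPotential_eq_realPotential h1 h2

lemma realPotential_le_realMaxPotential {m : ℕ} (μ : Fin m → Measure ℂ) (k : Fin m) (z : ℂ) :
    realPotential (μ k) z ≤ realMaxPotential μ z :=
  le_ciSup (f := fun k => realPotential (μ k) z) (Set.finite_range _).bddAbove k

lemma exists_realMaxPotential_eq {m : ℕ} [NeZero m] (μ : Fin m → Measure ℂ) (z : ℂ) :
    ∃ k, realMaxPotential μ z = realPotential (μ k) z := by
  obtain ⟨k, hk⟩ := exists_eq_ciSup_of_finite (f := fun k => realPotential (μ k) z)
  exact ⟨k, hk.symm⟩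

lemma ae_maxLogPotential_eq {m : ℕ} [NeZero m] {μ : Fin m → Measure ℂ}
    [∀ k, IsFiniteMeasure (μ k)] (h : ∀ k, IsCompact (μ k).support) :
    ∀ᵐ z, maxLogPotential μ z = (realMaxPotential μ z : EReal) := by
  filter_upwards [ae_all_iff.2 fun k => ae_logPotential_eq (h k)] with z hz
  refine le_antisymm (iSup_le fun k => ?_) ?_
  · rw [hz k, EReal.coe_le_coe_iff]
    exact realPotential_le_realMaxPotential μ k z
  · obtain ⟨k, hk⟩ := exists_realMaxPotential_eq μ z
    rw [hk, ← hz k]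
    exact le_iSup (fun k => logPotential (μ k) z) k

lemma memLp_realPotential {μ : Measure ℂ} [IsProbabilityMeasure μ] {S : ℝ}
    (hμ : ∀ᵐ w ∂μ, ‖w‖ ≤ S) (R : ℝ) :
    MemLp (realPotential μ) 2 (volume.restrict (Metric.closedBall (0 : ℂ) R)) := by
  have hsq := integrable_sq_log_norm_sub_prod measurable_id hμ R
  have hm := measurable_realPotential μ
  rw [memLp_two_iff_integrable_sq hm.aestronglyMeasurable]
  refine hsq.integral_prod_left.mono' (hm.pow_const 2).aestronglyMeasurable ?_
  filter_upwards [hsq.prod_right_ae, ae_restrict_of_ae (ae_memLp_log_norm_sub measurable_id hμ)]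
    with z h1 h2
  rw [Real.norm_eq_abs, abs_of_nonneg (sq_nonneg _)]
  exact (even_two.convexOn_pow (𝕜 := ℝ)).map_integral_le (by fun_prop) isClosed_univ (by simp)
    (h2.integrable (by norm_num)) h1

lemma abs_realMaxPotential_le {m : ℕ} [NeZero m] (μ : Fin m → Measure ℂ) (z : ℂ) :
    |realMaxPotential μ z| ≤ ∑ k, |realPotential (μ k) z| := by
  obtain ⟨k, hk⟩ := exists_realMaxPotential_eq μ z
  rw [hk]
  exact Finset.single_le_sum (f := fun k => |realPotential (μ k) z|) (fun _ _ => abs_nonneg _)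
    (Finset.mem_univ k)

lemma memLp_realMaxPotential {m : ℕ} [NeZero m] {μ : Fin m → Measure ℂ}
    [∀ k, IsProbabilityMeasure (μ k)] (h : ∀ k, IsCompact (μ k).support) (R : ℝ) :
    MemLp (realMaxPotential μ) 2 (volume.restrict (Metric.closedBall (0 : ℂ) R)) := by
  have hk : ∀ k, MemLp (fun z => |realPotential (μ k) z|) 2
      (volume.restrict (Metric.closedBall (0 : ℂ) R)) := fun k => by
    obtain ⟨S, -, hS⟩ := exists_ae_norm_le (h k)
    exact (memLp_realPotential hS R).abs
  refine (memLp_finsetSum Finset.univ fun k _ => hk k).mono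
    (measurable_realMaxPotential μ).aestronglyMeasurable (ae_of_all _ fun z => ?_)
  rw [Real.norm_eq_abs, Real.norm_eq_abs]
  exact (abs_realMaxPotential_le μ z).trans (le_abs_self _)

lemma locallyIntegrable_realMaxPotential {m : ℕ} [NeZero m] {μ : Fin m → Measure ℂ}
    [∀ k, IsProbabilityMeasure (μ k)] (h : ∀ k, IsCompact (μ k).support) :
    LocallyIntegrable (realMaxPotential μ) := by
  rw [locallyIntegrable_iff]
  intro K hK
  obtain ⟨R, hR⟩ := hK.isBounded.subset_closedBall 0
  have : IsFiniteMeasure (volume.restrict (Metric.closedBall (0 : ℂ) R)) :=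
    isFiniteMeasure_restrict.2 (isCompact_closedBall (0 : ℂ) R).measure_lt_top.ne
  have h1 : IntegrableOn (realMaxPotential μ) (Metric.closedBall 0 R) :=
    (memLp_realMaxPotential h R).integrable (by norm_num)
  exact h1.mono_set hR

/-- The kernel `log ‖z + r e^{iθ} - w‖` is integrable in `(θ, w)` for almost every `z`. -/
lemma ae_integrable_log_norm_circleMap_sub {μ : Measure ℂ} [IsFiniteMeasure μ] {S : ℝ}
    (hμ : ∀ᵐ w ∂μ, ‖w‖ ≤ S) (r : ℝ) :
    ∀ᵐ z : ℂ, Integrable (fun p : ℝ × ℂ => Real.log ‖circleMap z r p.1 - p.2‖)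
      ((volume.restrict (Set.Ioc 0 (2 * π))).prod μ) := by
  have hg : Measurable fun p : ℝ × ℂ => p.2 - circleMap 0 r p.1 := by
    have := continuous_circleMap 0 r
    exact (by fun_prop : Continuous _).measurable
  have hb : ∀ᵐ p ∂((volume.restrict (Set.Ioc 0 (2 * π))).prod μ),
      ‖p.2 - circleMap 0 r p.1‖ ≤ S + |r| := by
    filter_upwards [Measure.quasiMeasurePreserving_snd.ae hμ] with p hp
    refine (norm_sub_le _ _).trans ?_
    rw [norm_circleMap_zero]
    gcongr
  filter_upwards [ae_memLp_log_norm_sub hg hb] with z hz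
  refine (hz.integrable (by norm_num)).congr (ae_of_all _ fun p => ?_)
  simp only [circleMap]
  congr 2
  ring

/-- A maximum of logarithmic potentials is subharmonic: its circle averages dominate it. -/
theorem ae_circleDefect_realMaxPotential_nonneg {m : ℕ} [NeZero m] {μ : Fin m → Measure ℂ}
    [∀ k, IsProbabilityMeasure (μ k)] (h : ∀ k, IsCompact (μ k).support) {r : ℝ} (hr : 0 < r) :
    ∀ᵐ z, 0 ≤ circleDefect (realMaxPotential μ) r z := by
  choose S _ hS using fun k => exists_ae_norm_le (h k)
  filter_upwards [ae_all_iff.2 fun k => ae_integrable_log_norm_circleMap_sub (hS k) r,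
    ae_all_iff.2 fun k => ae_integrable_log_norm_sub (hS k),
    ae_all_iff.2 fun k => ae_ae_ne (μ k)] with z h1 h2 h3
  have hcm := measurable_circleMap z r
  have hu : ∀ k, IntegrableOn (fun θ => realPotential (μ k) (circleMap z r θ))
      (Set.Ioc 0 (2 * π)) := fun k => (h1 k).integral_prod_left
  have hU : IntegrableOn (fun θ => realMaxPotential μ (circleMap z r θ)) (Set.Ioc 0 (2 * π)) := by
    have hsum : IntegrableOn (fun θ => ∑ k, |realPotential (μ k) (circleMap z r θ)|)
        (Set.Ioc 0 (2 * π)) := integrable_finsetSum _ fun k _ => (hu k).abs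
    exact hsum.mono' ((measurable_realMaxPotential μ).comp hcm).aestronglyMeasurable
      (ae_of_all _ fun θ => abs_realMaxPotential_le μ _)
  obtain ⟨k, hk⟩ := exists_realMaxPotential_eq μ z
  have hvol : volume.real (Set.Ioc 0 (2 * π)) = 2 * π := by
    rw [Real.volume_real_Ioc, sub_zero, max_eq_left Real.two_pi_pos.le]
  have hk1 : 2 * π * realPotential (μ k) z
      ≤ ∫ θ in Set.Ioc 0 (2 * π), realPotential (μ k) (circleMap z r θ) := by
    have hswap : ∫ θ in Set.Ioc 0 (2 * π), realPotential (μ k) (circleMap z r θ)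
        = ∫ w, (∫ θ in Set.Ioc 0 (2 * π), Real.log ‖circleMap z r θ - w‖) ∂μ k :=
      integral_integral_swap (f := fun θ w => Real.log ‖circleMap z r θ - w‖) (h1 k)
    rw [hswap, realPotential, ← integral_const_mul]
    refine integral_mono_ae ((h2 k).const_mul _) (h1 k).integral_prod_right ?_
    filter_upwards [h3 k] with w hw
    have := circleDefect_log_norm_sub hw hr
    rw [circleDefect, integral_sub (integrableOn_log_norm_circleMap_sub z w r)
      (integrable_const _)] at this
    simp only [integral_const, smul_eq_mul, measureReal_restrict_apply_univ, hvol] at this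
    have hpos : 0 ≤ 2 * π * Real.posLog ‖r⁻¹ • (z - w)‖⁻¹ :=
      mul_nonneg Real.two_pi_pos.le Real.posLog_nonneg
    linarith
  have hk2 : ∫ θ in Set.Ioc 0 (2 * π), realPotential (μ k) (circleMap z r θ)
      ≤ ∫ θ in Set.Ioc 0 (2 * π), realMaxPotential μ (circleMap z r θ) :=
    integral_mono (hu k) hU fun θ => realPotential_le_realMaxPotential μ k _
  rw [circleDefect, integral_sub hU (integrable_const _), hk]
  simp only [integral_const, smul_eq_mul, measureReal_restrict_apply_univ, hvol]
  linarith

lemma abs_log_norm_sub_sub_log_norm_le {S : ℝ} (hS : 0 < S) {z w : ℂ} (hz : 2 * S ≤ ‖z‖)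
    (hw : ‖w‖ ≤ S) : |Real.log ‖z - w‖ - Real.log ‖z‖| ≤ 2 * S / ‖z‖ := by
  have hz0 : 0 < ‖z‖ := by linarith
  have hlow : ‖z‖ - S ≤ ‖z - w‖ := by linarith [norm_sub_norm_le z w]
  have hupp : ‖z - w‖ ≤ ‖z‖ + S := by linarith [norm_sub_le z w]
  have hd0 : 0 < ‖z - w‖ := by linarith
  rw [abs_le]
  constructor
  · have h1 := Real.log_le_sub_one_of_pos (div_pos hz0 hd0)
    rw [Real.log_div hz0.ne' hd0.ne'] at h1
    have h2 : ‖z‖ / ‖z - w‖ - 1 ≤ 2 * S / ‖z‖ := by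
      rw [div_sub_one hd0.ne', div_le_div_iff₀ hd0 hz0]
      nlinarith
    linarith
  · have h1 := Real.log_le_sub_one_of_pos (div_pos hd0 hz0)
    rw [Real.log_div hd0.ne' hz0.ne'] at h1
    have h2 : ‖z - w‖ / ‖z‖ - 1 ≤ 2 * S / ‖z‖ := by
      rw [div_sub_one hz0.ne', div_le_div_iff_of_pos_right hz0]
      linarith
    linarith

lemma abs_realPotential_sub_log_norm_le {μ : Measure ℂ} [IsProbabilityMeasure μ] {S : ℝ}
    (hS : 0 < S) (hμ : ∀ᵐ w ∂μ, ‖w‖ ≤ S) {z : ℂ} (hz : 2 * S ≤ ‖z‖) :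
    |realPotential μ z - Real.log ‖z‖| ≤ 2 * S / ‖z‖ := by
  have hb : ∀ᵐ w ∂μ, ‖Real.log ‖z - w‖ - Real.log ‖z‖‖ ≤ 2 * S / ‖z‖ := by
    filter_upwards [hμ] with w hw
    exact abs_log_norm_sub_sub_log_norm_le hS hz hw
  have hm : Measurable fun w : ℂ => Real.log ‖z - w‖ - Real.log ‖z‖ := by fun_prop
  have hi : Integrable (fun w => Real.log ‖z - w‖ - Real.log ‖z‖) μ :=
    Integrable.of_bound hm.aestronglyMeasurable _ hb
  have hi2 : Integrable (fun w => Real.log ‖z - w‖) μ :=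
    (hi.add (integrable_const (Real.log ‖z‖))).congr (ae_of_all _ fun w => by simp)
  have h1 := norm_integral_le_of_norm_le_const hb
  rw [integral_sub hi2 (integrable_const _)] at h1
  simpa [realPotential] using h1

/-- A maximum of potentials of probability measures is `log ‖z‖ + O(1 / ‖z‖)` at infinity. -/
lemma abs_realMaxPotential_sub_log_norm_le {m : ℕ} [NeZero m] {μ : Fin m → Measure ℂ}
    [∀ k, IsProbabilityMeasure (μ k)] {S : ℝ} (hS : 0 < S) (hμ : ∀ k, ∀ᵐ w ∂μ k, ‖w‖ ≤ S)
    {z : ℂ} (hz : 2 * S ≤ ‖z‖) : |realMaxPotential μ z - Real.log ‖z‖| ≤ 2 * S / ‖z‖ := by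
  obtain ⟨k, hk⟩ := exists_realMaxPotential_eq μ z
  rw [hk]
  exact abs_realPotential_sub_log_norm_le hS (hμ k) hz

lemma exists_forall_ae_norm_le {m : ℕ} {μ : Fin m → Measure ℂ}
    (h : ∀ k, IsCompact (μ k).support) : ∃ S : ℝ, 0 < S ∧ ∀ k, ∀ᵐ w ∂μ k, ‖w‖ ≤ S := by
  choose S hS0 hS using fun k => exists_ae_norm_le (h k)
  have h0 := Finset.sum_nonneg fun k (_ : k ∈ Finset.univ) => (hS0 k).le
  refine ⟨1 + ∑ k, S k, by linarith, fun k => ?_⟩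
  filter_upwards [hS k] with w hw
  have := Finset.single_le_sum (f := S) (fun k _ => (hS0 k).le) (Finset.mem_univ k)
  linarith

/-! ### Positive distributions are measures -/

lemma two_le_coe_top : (2 : WithTop ℕ∞) ≤ ((⊤ : ℕ∞) : WithTop ℕ∞) := by
  exact WithTop.coe_le_coe.2 (le_top : (2 : ℕ∞) ≤ ⊤)

lemma continuous_laplacian {ψ : ℂ → ℝ} (hψ : ContDiff ℝ 2 ψ) :
    Continuous (Laplacian.laplacian ψ) := by
  have hcD : Continuous (fderiv ℝ (fderiv ℝ ψ)) :=
    (hψ.fderiv_right (m := 1) (by norm_num)).continuous_fderiv (by norm_num)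
  rw [funext (laplacian_eq_fderiv_fderiv ψ)]
  fun_prop

lemma laplacian_eq_zero_of_eventuallyEq_const {F : Type*} [NormedAddCommGroup F] [NormedSpace ℝ F]
    {ψ : ℂ → F} {z : ℂ} {c : F} (h : ψ =ᶠ[𝓝 z] fun _ => c) : Laplacian.laplacian ψ z = 0 := by
  rw [InnerProductSpace.laplacian_congr_nhds h |>.eq_of_nhds]
  simp

lemma laplacian_eq_zero_of_notMem_tsupport {F : Type*} [NormedAddCommGroup F] [NormedSpace ℝ F]
    {ψ : ℂ → F} {z : ℂ} (hz : z ∉ tsupport ψ) : Laplacian.laplacian ψ z = 0 :=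
  laplacian_eq_zero_of_eventuallyEq_const (notMem_tsupport_iff_eventuallyEq.1 hz)

lemma hasCompactSupport_laplacian {ψ : ℂ → ℝ} (hc : HasCompactSupport ψ) :
    HasCompactSupport (Laplacian.laplacian ψ) :=
  HasCompactSupport.intro hc.isCompact fun _ hz => laplacian_eq_zero_of_notMem_tsupport hz

lemma integrable_laplacian_mul {ψ : ℂ → ℝ} (hψ : ContDiff ℝ 2 ψ) (hc : HasCompactSupport ψ)
    {V : ℂ → ℝ} (hV : LocallyIntegrable V) :
    Integrable fun z => Laplacian.laplacian ψ z * V z := by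
  simpa using hV.integrable_smul_left_of_hasCompactSupport (continuous_laplacian hψ)
    (hasCompactSupport_laplacian hc)

lemma laplacian_comp_smul {ψ : ℂ → ℝ} (hψ : ContDiff ℝ 2 ψ) (c : ℝ) (z : ℂ) :
    Laplacian.laplacian (fun z => ψ (c • z)) z = c ^ 2 * Laplacian.laplacian ψ (c • z) := by
  have hD : Differentiable ℝ (fderiv ℝ ψ) :=
    (hψ.fderiv_right (m := 1) (by norm_num)).differentiable (by norm_num)
  have h1 : fderiv ℝ (fun z => ψ (c • z)) = fun z => c • fderiv ℝ ψ (c • z) :=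
    funext fun z => fderiv_comp_smul c
  have hs : HasFDerivAt (fun z : ℂ => c • z) (c • ContinuousLinearMap.id ℝ ℂ) z :=
    (hasFDerivAt_id z).const_smul c
  have h2 : HasFDerivAt (fun z => c • fderiv ℝ ψ (c • z))
      (c • (fderiv ℝ (fderiv ℝ ψ) (c • z)).comp (c • ContinuousLinearMap.id ℝ ℂ)) z :=
    (((hD (c • z)).hasFDerivAt).comp z hs).const_smul c
  rw [laplacian_eq_fderiv_fderiv, laplacian_eq_fderiv_fderiv, h1, h2.fderiv]
  simp only [_root_.smul_apply, ContinuousLinearMap.comp_apply, ContinuousLinearMap.id_apply,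
    map_smul, smul_eq_mul]
  ring

open CompactlySupported in
/-- A functional `ψ ↦ ∫ Δψ V` which is positive on smooth functions extends to a positive functional
on all compactly supported continuous functions (M. Riesz), hence is given by a measure
(Riesz-Markov-Kakutani). -/
theorem exists_measure_of_laplacian_nonneg {V : ℂ → ℝ} (hV : LocallyIntegrable V)
    (hpos : ∀ ψ : ℂ → ℝ, ContDiff ℝ ((⊤ : ℕ∞) : WithTop ℕ∞) ψ → HasCompactSupport ψ →
      (∀ z, 0 ≤ ψ z) → 0 ≤ ∫ z, Laplacian.laplacian ψ z * V z) :
    ∃ ρ : Measure ℂ, ρ.Regular ∧ ∀ ψ : ℂ → ℝ, ContDiff ℝ ((⊤ : ℕ∞) : WithTop ℕ∞) ψ →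
      HasCompactSupport ψ → ∫ z, ψ z ∂ρ = (2 * π)⁻¹ * ∫ z, Laplacian.laplacian ψ z * V z := by
  have hle := two_le_coe_top
  let p : Submodule ℝ C_c(ℂ, ℝ) :=
    { carrier := {f | ContDiff ℝ ((⊤ : ℕ∞) : WithTop ℕ∞) f}
      add_mem' := fun {f g} hf hg => by
        have hf' : ContDiff ℝ ((⊤ : ℕ∞) : WithTop ℕ∞) f := hf
        have hg' : ContDiff ℝ ((⊤ : ℕ∞) : WithTop ℕ∞) g := hg
        exact hf'.add hg'
      zero_mem' := by
        have : ContDiff ℝ ((⊤ : ℕ∞) : WithTop ℕ∞) fun _ : ℂ => (0 : ℝ) := contDiff_const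
        exact this
      smul_mem' := fun c f hf => by
        have hf' : ContDiff ℝ ((⊤ : ℕ∞) : WithTop ℕ∞) f := hf
        exact hf'.const_smul c }
  have hp : ∀ f : p, ContDiff ℝ ((⊤ : ℕ∞) : WithTop ℕ∞) ⇑(f : C_c(ℂ, ℝ)) := fun f => f.2
  let L : p →ₗ[ℝ] ℝ :=
    { toFun := fun f => (2 * π)⁻¹ * ∫ z, Laplacian.laplacian ⇑(f : C_c(ℂ, ℝ)) z * V z
      map_add' := fun f g => by
        have hf : ContDiff ℝ 2 ⇑(f : C_c(ℂ, ℝ)) := (hp f).of_le hle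
        have hg : ContDiff ℝ 2 ⇑(g : C_c(ℂ, ℝ)) := (hp g).of_le hle
        rw [← mul_add, ← integral_add
          (integrable_laplacian_mul hf (f : C_c(ℂ, ℝ)).hasCompactSupport hV)
          (integrable_laplacian_mul hg (g : C_c(ℂ, ℝ)).hasCompactSupport hV)]
        congr 1
        refine integral_congr_ae (ae_of_all _ fun z => ?_)
        beta_reduce
        rw [← add_mul, ← hf.contDiffAt.laplacian_add hg.contDiffAt]
        rfl
      map_smul' := fun c f => by
        have hf : ContDiff ℝ 2 ⇑(f : C_c(ℂ, ℝ)) := (hp f).of_le hle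
        rw [RingHom.id_apply, smul_eq_mul, mul_left_comm, ← integral_const_mul c]
        congr 1
        refine integral_congr_ae (ae_of_all _ fun z => ?_)
        beta_reduce
        rw [← mul_assoc, ← smul_eq_mul c, ← InnerProductSpace.laplacian_smul c hf.contDiffAt]
        rfl }
  let s : PointedCone ℝ C_c(ℂ, ℝ) :=
    { carrier := {f | ∀ z, 0 ≤ f z}
      add_mem' := fun {f g} hf hg z => add_nonneg (hf z) (hg z)
      zero_mem' := fun z => le_rfl
      smul_mem' := fun c f hf z => mul_nonneg c.2 (hf z) }
  obtain ⟨g, hg, hgpos⟩ := riesz_extension s (⟨p, L⟩ : C_c(ℂ, ℝ) →ₗ.[ℝ] ℝ)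
    (fun x hx => mul_nonneg (by positivity)
      (hpos _ (hp x) (x : C_c(ℂ, ℝ)).hasCompactSupport hx))
    (fun y => by
      obtain ⟨C, hC⟩ := y.hasCompactSupport.exists_bound_of_continuous y.continuous
      obtain ⟨R, hR0, hR⟩ := y.hasCompactSupport.isCompact.isBounded.subset_closedBall_lt 0 0
      let χ : ContDiffBump (0 : ℂ) := ⟨R, R + 1, hR0, by linarith⟩
      have hχ : ContDiff ℝ ((⊤ : ℕ∞) : WithTop ℕ∞) (χ : ℂ → ℝ) := χ.contDiff
      have hC0 : 0 ≤ C := (norm_nonneg _).trans (hC 0)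
      have hsm : ContDiff ℝ ((⊤ : ℕ∞) : WithTop ℕ∞) fun z : ℂ => C * χ z :=
        contDiff_const.mul hχ
      refine ⟨⟨⟨⟨fun z => C * χ z, hsm.continuous⟩, χ.hasCompactSupport.mul_left⟩, hsm⟩, fun z => ?_⟩
      change 0 ≤ C * χ z + y z
      by_cases hz : z ∈ tsupport y
      · rw [χ.one_of_mem_closedBall (hR hz)]
        have := (abs_le.1 (hC z)).1
        linarith
      · rw [image_eq_zero_of_notMem_tsupport hz, add_zero]
        exact mul_nonneg hC0 χ.nonneg)
  let Λ : C_c(ℂ, ℝ) →ₚ[ℝ] ℝ := PositiveLinearMap.mk₀ g fun f hf => hgpos f hf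
  refine ⟨RealRMK.rieszMeasure Λ, inferInstance, fun ψ hψ hc => ?_⟩
  have h1 := RealRMK.integral_rieszMeasure Λ ⟨⟨ψ, hψ.continuous⟩, hc⟩
  have h2 := hg ⟨⟨⟨ψ, hψ.continuous⟩, hc⟩, hψ⟩
  exact h1.trans h2

/-- The cutoff functions used to compute total masses: equal to `1` on the disc of radius `R` and
vanishing outside the disc of radius `2R`. -/
noncomputable def cutoff (R : ℝ) (z : ℂ) : ℝ :=
  (⟨1, 2, one_pos, one_lt_two⟩ : ContDiffBump (0 : ℂ)) (R⁻¹ • z)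

lemma cutoff_eq_comp_smul (R : ℝ) : cutoff R = fun z => cutoff 1 (R⁻¹ • z) := by
  ext z
  simp [cutoff]

lemma contDiff_cutoff (R : ℝ) : ContDiff ℝ ((⊤ : ℕ∞) : WithTop ℕ∞) (cutoff R) := by
  unfold cutoff
  exact ContDiffBump.contDiff _ |>.comp (contDiff_const_smul _)

lemma cutoff_nonneg (R : ℝ) (z : ℂ) : 0 ≤ cutoff R z := ContDiffBump.nonneg _

lemma cutoff_le_one (R : ℝ) (z : ℂ) : cutoff R z ≤ 1 := ContDiffBump.le_one _

lemma cutoff_eq_one {R : ℝ} (hR : 0 < R) {z : ℂ} (hz : ‖z‖ ≤ R) : cutoff R z = 1 := by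
  refine ContDiffBump.one_of_mem_closedBall _ ?_
  rw [mem_closedBall_zero_iff, norm_smul, Real.norm_eq_abs, abs_of_pos (inv_pos.2 hR)]
  exact (inv_mul_le_one₀ hR).2 hz

lemma hasCompactSupport_cutoff {R : ℝ} (hR : 0 < R) : HasCompactSupport (cutoff R) := by
  unfold cutoff
  exact (ContDiffBump.hasCompactSupport _).comp_smul (inv_ne_zero hR.ne')

lemma laplacian_cutoff_eq_zero {R : ℝ} (hR : 0 < R) {z : ℂ} (hz : ‖z‖ < R) :
    Laplacian.laplacian (cutoff R) z = 0 := by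
  refine laplacian_eq_zero_of_eventuallyEq_const (c := 1) ?_
  filter_upwards [Metric.isOpen_ball.mem_nhds (mem_ball_zero_iff.2 hz)] with w hw
  exact cutoff_eq_one hR (mem_ball_zero_iff.1 hw).le

lemma integral_abs_laplacian_cutoff {R : ℝ} (hR : 0 < R) :
    ∫ z, |Laplacian.laplacian (cutoff R) z| = ∫ z, |Laplacian.laplacian (cutoff 1) z| := by
  have hle := two_le_coe_top
  rw [cutoff_eq_comp_smul R]
  simp_rw [laplacian_comp_smul ((contDiff_cutoff 1).of_le hle), abs_mul, integral_const_mul]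
  rw [Measure.integral_comp_smul_of_nonneg volume
    (fun z : ℂ => |Laplacian.laplacian (cutoff 1) z|) R⁻¹ (hR := (inv_pos.2 hR).le),
    Complex.finrank_real_complex, smul_eq_mul, ← mul_assoc, abs_of_nonneg (sq_nonneg _),
    mul_inv_cancel₀ (by positivity), one_mul]

/-- Testing the Laplacian of `V = log ‖z‖ + O(1 / ‖z‖)` against cutoff functions gives total mass
`2π`. -/
lemma tendsto_integral_laplacian_cutoff_mul {V : ℂ → ℝ} (hV : LocallyIntegrable V) {A B : ℝ}
    (hinf : ∀ z, A ≤ ‖z‖ → |V z - Real.log ‖z‖| ≤ B / ‖z‖) :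
    Tendsto (fun n : ℕ => ∫ z, Laplacian.laplacian (cutoff (n + 1)) z * V z) atTop
      (𝓝 (2 * π)) := by
  have hle := two_le_coe_top
  set J := ∫ z, |Laplacian.laplacian (cutoff 1) z|
  rw [tendsto_iff_norm_sub_tendsto_zero]
  have hlim : Tendsto (fun n : ℕ => |B| * J * (1 / ((n : ℝ) + 1))) atTop (𝓝 0) := by
    simpa using tendsto_one_div_add_atTop_nhds_zero_nat.const_mul (|B| * J)
  refine squeeze_zero' (Eventually.of_forall fun _ => norm_nonneg _) ?_ hlim
  filter_upwards [eventually_ge_atTop ⌈A⌉₊] with n hn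
  have hn0 : (0 : ℝ) < n + 1 := by positivity
  have hA : A ≤ n + 1 := (Nat.le_ceil A).trans ((Nat.cast_le.2 hn).trans (by linarith))
  have hs : ContDiff ℝ 2 (cutoff (n + 1)) := (contDiff_cutoff _).of_le hle
  have hc := hasCompactSupport_cutoff hn0
  have hlogint : LocallyIntegrable fun z : ℂ => Real.log ‖z‖ := by
    simpa using locallyIntegrable_log_norm_sub 0
  have h1 : ∫ z, Laplacian.laplacian (cutoff (n + 1)) z * Real.log ‖z‖ = 2 * π := by
    have := integral_laplacian_mul_log_norm_sub hs hc 0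
    simpa [cutoff_eq_one hn0 (z := 0) (by simpa using hn0.le)] using this
  rw [← h1, ← integral_sub (integrable_laplacian_mul hs hc hV)
    (integrable_laplacian_mul hs hc hlogint)]
  have hi : Integrable fun z => |Laplacian.laplacian (cutoff (n + 1)) z| :=
    ((continuous_laplacian hs).integrable_of_hasCompactSupport
      (hasCompactSupport_laplacian hc)).abs
  calc ‖∫ z, (Laplacian.laplacian (cutoff (n + 1)) z * V z
        - Laplacian.laplacian (cutoff (n + 1)) z * Real.log ‖z‖)‖
      ≤ ∫ z, |Laplacian.laplacian (cutoff (n + 1)) z| * (|B| / (n + 1)) := by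
        refine norm_integral_le_of_norm_le (hi.mul_const _) (ae_of_all _ fun z => ?_)
        rw [← mul_sub, norm_mul, Real.norm_eq_abs, Real.norm_eq_abs]
        rcases lt_or_ge ‖z‖ (n + 1) with hz | hz
        · simp [laplacian_cutoff_eq_zero hn0 hz]
        · gcongr
          refine (hinf z (hA.trans hz)).trans ?_
          exact div_le_div₀ (abs_nonneg _) (le_abs_self _) hn0 hz
    _ = |B| * J * (1 / ((n : ℝ) + 1)) := by
        rw [integral_mul_const, integral_abs_laplacian_cutoff hn0]
        ring

lemma isProbabilityMeasure_of_tendsto_integral_cutoff {ρ : Measure ℂ}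
    [IsFiniteMeasureOnCompacts ρ]
    (h : Tendsto (fun n : ℕ => ∫ z, cutoff (n + 1) z ∂ρ) atTop (𝓝 1)) :
    IsProbabilityMeasure ρ := by
  have hlim : Tendsto (fun n : ℕ => ∫⁻ z, ENNReal.ofReal (cutoff (n + 1) z) ∂ρ) atTop (𝓝 1) := by
    have h1 : Tendsto (fun n : ℕ => ENNReal.ofReal (∫ z, cutoff (n + 1) z ∂ρ)) atTop (𝓝 1) := by
      simpa using ENNReal.tendsto_ofReal h
    refine h1.congr fun n => ?_
    exact ofReal_integral_eq_lintegral_ofReal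
      ((contDiff_cutoff _).continuous.integrable_of_hasCompactSupport
        (hasCompactSupport_cutoff (by positivity))) (ae_of_all _ fun z => cutoff_nonneg _ z)
  refine ⟨le_antisymm ?_ ?_⟩
  · have hpt : ∀ z, liminf (fun n : ℕ => ENNReal.ofReal (cutoff (n + 1) z)) atTop = 1 := fun z => by
      refine Tendsto.liminf_eq (tendsto_const_nhds.congr' ?_)
      filter_upwards [eventually_ge_atTop ⌈‖z‖⌉₊] with n hn
      rw [cutoff_eq_one (by positivity) ((Nat.le_ceil ‖z‖).trans
        ((Nat.cast_le.2 hn).trans (by linarith))), ENNReal.ofReal_one]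
    have := lintegral_liminf_le (μ := ρ) (u := atTop)
      (f := fun (n : ℕ) z => ENNReal.ofReal (cutoff (n + 1) z))
      fun n => (contDiff_cutoff _).continuous.measurable.ennreal_ofReal
    simp only [hpt, lintegral_const, one_mul, hlim.liminf_eq] at this
    exact this
  · refine le_of_tendsto hlim (Eventually.of_forall fun n => ?_)
    calc ∫⁻ z, ENNReal.ofReal (cutoff (n + 1) z) ∂ρ ≤ ∫⁻ _, 1 ∂ρ :=
          lintegral_mono fun z => by
            simpa using ENNReal.ofReal_le_ofReal (cutoff_le_one (n + 1) z)
      _ = ρ Set.univ := by simp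

/-- A locally finite measure on the plane is determined by its integrals against real valued test
functions: the functions `1 - (1 - f) ^ n` increase to the indicator function of `{f ≠ 0}`. -/
theorem measure_ext_of_integral_contDiff {ρ ρ' : Measure ℂ} [IsFiniteMeasureOnCompacts ρ]
    [IsFiniteMeasureOnCompacts ρ']
    (h : ∀ ψ : ℂ → ℝ, ContDiff ℝ ((⊤ : ℕ∞) : WithTop ℕ∞) ψ → HasCompactSupport ψ →
      ∫ z, ψ z ∂ρ = ∫ z, ψ z ∂ρ') : ρ = ρ' := by
  have key : ∀ s : Set ℂ, IsOpen s → Bornology.IsBounded s → ρ s = ρ' s := by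
    intro s hs hb
    obtain ⟨f, hfs, hfc, hfr⟩ := hs.exists_contDiff_support_eq (n := ⊤)
    have hK : IsCompact (closure s) := hb.isCompact_closure
    have hf0 : ∀ z, 0 ≤ f z ∧ f z ≤ 1 := fun z => hfr ⟨z, rfl⟩
    have hout : ∀ (n : ℕ) z, z ∉ s → 1 - (1 - f z) ^ n = 0 := fun n z hz => by
      rw [← hfs, Function.notMem_support] at hz
      simp [hz]
    have hcs : ∀ n : ℕ, HasCompactSupport fun z => 1 - (1 - f z) ^ n := fun n =>
      HasCompactSupport.intro hK fun z hz => hout n z fun hz' => hz (subset_closure hz')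
    have hsm : ∀ n : ℕ, ContDiff ℝ ((⊤ : ℕ∞) : WithTop ℕ∞) fun z => 1 - (1 - f z) ^ n := fun n =>
      contDiff_const.sub ((contDiff_const.sub hfc).pow n)
    have hlim : ∀ ν : Measure ℂ, IsFiniteMeasureOnCompacts ν →
        Tendsto (fun n : ℕ => ∫ z, (1 - (1 - f z) ^ n) ∂ν) atTop (𝓝 (ν.real s)) := by
      intro ν hν
      rw [← integral_indicator_one hs.measurableSet]
      refine tendsto_integral_of_dominated_convergence ((closure s).indicator fun _ => (1 : ℝ))
        (fun n => (hsm n).continuous.aestronglyMeasurable) ?_ (fun n => ae_of_all _ fun z => ?_)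
        (ae_of_all _ fun z => ?_)
      · rw [integrable_indicator_iff isClosed_closure.measurableSet]
        exact integrableOn_const hK.measure_lt_top.ne
      · by_cases hz : z ∈ s
        · rw [Set.indicator_of_mem (subset_closure hz), Real.norm_eq_abs, abs_le]
          have h1 : 0 ≤ (1 - f z) ^ n := pow_nonneg (by linarith [(hf0 z).2]) n
          have h2 : (1 - f z) ^ n ≤ 1 :=
            pow_le_one₀ (by linarith [(hf0 z).2]) (by linarith [(hf0 z).1])
          constructor <;> linarith
        · rw [hout n z hz, norm_zero]
          exact Set.indicator_nonneg (fun _ _ => zero_le_one) _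
      · by_cases hz : z ∈ s
        · rw [Set.indicator_of_mem hz]
          have hfz : f z ≠ 0 := by rwa [← hfs] at hz
          have hfz' : 0 < f z := lt_of_le_of_ne (hf0 z).1 hfz.symm
          have := (tendsto_pow_atTop_nhds_zero_of_lt_one (r := 1 - f z) (by linarith [(hf0 z).2])
            (by linarith)).const_sub 1
          simpa using this
        · rw [Set.indicator_of_notMem hz]
          exact tendsto_const_nhds.congr fun n => (hout n z hz).symm
    have heq : ρ.real s = ρ'.real s := by
      refine tendsto_nhds_unique (hlim ρ inferInstance) ?_
      refine (hlim ρ' inferInstance).congr fun n => ?_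
      exact (h _ (hsm n) (hcs n)).symm
    have f1 : ρ s ≠ ∞ := ((measure_mono subset_closure).trans_lt hK.measure_lt_top).ne
    have f2 : ρ' s ≠ ∞ := ((measure_mono subset_closure).trans_lt hK.measure_lt_top).ne
    exact (ENNReal.toReal_eq_toReal_iff' f1 f2).1 heq
  refine Measure.ext_of_generateFrom_of_iUnion {s | IsOpen s ∧ Bornology.IsBounded s}
    (fun n : ℕ => Metric.ball 0 n) ?_ ?_ (Metric.iUnion_ball_nat 0)
    (fun n => ⟨Metric.isOpen_ball, Metric.isBounded_ball⟩) (fun n => ?_) fun s hs => key s hs.1 hs.2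
  · rw [BorelSpace.measurable_eq (α := ℂ), borel]
    refine le_antisymm (MeasurableSpace.generateFrom_le fun s hs => ?_)
      (MeasurableSpace.generateFrom_mono fun s hs => hs.1)
    have : s = ⋃ n : ℕ, s ∩ Metric.ball 0 n := by
      rw [← Set.inter_iUnion, Metric.iUnion_ball_nat, Set.inter_univ]
    rw [this]
    have hs' : IsOpen s := hs
    exact MeasurableSet.iUnion fun n => MeasurableSpace.measurableSet_generateFrom
      ⟨hs'.inter Metric.isOpen_ball, Metric.isBounded_ball.subset Set.inter_subset_right⟩
  · rintro s ⟨hs, hsb⟩ t ⟨ht, -⟩ -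
    exact ⟨hs.inter ht, hsb.subset Set.inter_subset_left⟩
  · exact ((measure_mono Metric.ball_subset_closedBall).trans_lt
      (isCompact_closedBall (0 : ℂ) n).measure_lt_top).ne

/-! ### The Laplacian of the maximum of potentials -/

lemma IsTestFunction.re {φ : ℂ → ℂ} (hφ : IsTestFunction φ) :
    ContDiff ℝ ((⊤ : ℕ∞) : WithTop ℕ∞) (fun z => (φ z).re) ∧
      HasCompactSupport (fun z => (φ z).re) :=
  ⟨Complex.reCLM.contDiff.comp hφ.1, hφ.2.comp_left (g := Complex.re) rfl⟩

lemma IsTestFunction.im {φ : ℂ → ℂ} (hφ : IsTestFunction φ) :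
    ContDiff ℝ ((⊤ : ℕ∞) : WithTop ℕ∞) (fun z => (φ z).im) ∧
      HasCompactSupport (fun z => (φ z).im) :=
  ⟨Complex.imCLM.contDiff.comp hφ.1, hφ.2.comp_left (g := Complex.im) rfl⟩

lemma laplacian_eq_re_add_im {φ : ℂ → ℂ} (hφ : IsTestFunction φ) (z : ℂ) :
    Laplacian.laplacian φ z = (Laplacian.laplacian (fun z => (φ z).re) z : ℂ)
      + (Laplacian.laplacian (fun z => (φ z).im) z : ℂ) * Complex.I := by
  have h2 : ContDiffAt ℝ 2 φ z := (hφ.1.of_le two_le_coe_top).contDiffAt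
  have hre : Laplacian.laplacian (fun z => (φ z).re) z = (Laplacian.laplacian φ z).re :=
    h2.laplacian_CLM_comp_left (l := Complex.reCLM)
  have him : Laplacian.laplacian (fun z => (φ z).im) z = (Laplacian.laplacian φ z).im :=
    h2.laplacian_CLM_comp_left (l := Complex.imCLM)
  rw [hre, him, Complex.re_add_im]

/-- An identity `ρ = (1 / 2π) Δ V` tested against real functions also holds against complex ones. -/
lemma integral_eq_of_forall_real {ρ : Measure ℂ} [IsFiniteMeasureOnCompacts ρ] {V : ℂ → ℝ}
    (hV : LocallyIntegrable V)
    (h : ∀ ψ : ℂ → ℝ, ContDiff ℝ ((⊤ : ℕ∞) : WithTop ℕ∞) ψ → HasCompactSupport ψ →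
      ∫ z, ψ z ∂ρ = (2 * π)⁻¹ * ∫ z, Laplacian.laplacian ψ z * V z)
    {φ : ℂ → ℂ} (hφ : IsTestFunction φ) :
    ∫ z, φ z ∂ρ = (1 / (2 * π) : ℂ) * ∫ z, Laplacian.laplacian φ z * (V z : ℂ) := by
  obtain ⟨hr, hrc⟩ := hφ.re
  obtain ⟨hi, hic⟩ := hφ.im
  have e1 : ∫ z, φ z ∂ρ = ((∫ z, (φ z).re ∂ρ : ℝ) : ℂ)
      + ((∫ z, (φ z).im ∂ρ : ℝ) : ℂ) * Complex.I := by
    rw [← integral_complex_ofReal, ← integral_complex_ofReal, ← integral_mul_const, ← integral_add]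
    · simp [Complex.re_add_im]
    · exact (hr.continuous.integrable_of_hasCompactSupport hrc).ofReal
    · exact (hi.continuous.integrable_of_hasCompactSupport hic).ofReal.mul_const _
  have e2 : ∫ z, Laplacian.laplacian φ z * (V z : ℂ)
      = ((∫ z, Laplacian.laplacian (fun z => (φ z).re) z * V z : ℝ) : ℂ)
      + ((∫ z, Laplacian.laplacian (fun z => (φ z).im) z * V z : ℝ) : ℂ) * Complex.I := by
    rw [← integral_complex_ofReal, ← integral_complex_ofReal, ← integral_mul_const, ← integral_add]
    · refine integral_congr_ae (ae_of_all _ fun z => ?_)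
      beta_reduce
      rw [laplacian_eq_re_add_im hφ]
      push_cast
      ring
    · exact (integrable_laplacian_mul (hr.of_le two_le_coe_top) hrc hV).ofReal
    · exact (integrable_laplacian_mul (hi.of_le two_le_coe_top) hic hV).ofReal.mul_const _
  rw [e1, e2, h _ hr hrc, h _ hi hic]
  push_cast
  ring

/-- `(1 / 2π) log ‖z - w‖` is a fundamental solution of the Laplacian, with complex valued test
functions. -/
lemma integral_laplacian_mul_log_norm_sub_complex {φ : ℂ → ℂ} (hφ : IsTestFunction φ) (w : ℂ) :
    φ w = (1 / (2 * π) : ℂ) * ∫ z, Laplacian.laplacian φ z * (Real.log ‖z - w‖ : ℂ) := by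
  rw [← integral_eq_of_forall_real (ρ := Measure.dirac w) (locallyIntegrable_log_norm_sub w) ?_ hφ,
    integral_dirac]
  intro ψ hψ hc
  rw [integral_laplacian_mul_log_norm_sub (hψ.of_le two_le_coe_top) hc, integral_dirac,
    inv_mul_cancel_left₀ Real.two_pi_pos.ne']

lemma integral_laplacian_mul_realMaxPotential_nonneg {m : ℕ} [NeZero m] {μ : Fin m → Measure ℂ}
    [∀ k, IsProbabilityMeasure (μ k)] (h : ∀ k, IsCompact (μ k).support) {ψ : ℂ → ℝ}
    (hψ : ContDiff ℝ 2 ψ) (hc : HasCompactSupport ψ) (hpos : ∀ z, 0 ≤ ψ z) :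
    0 ≤ ∫ z, Laplacian.laplacian ψ z * realMaxPotential μ z := by
  have h1 := tendsto_integral_mul_circleDefect hψ hc (locallyIntegrable_realMaxPotential h)
  have h2 : 0 ≤ π / 2 * ∫ z, Laplacian.laplacian ψ z * realMaxPotential μ z := by
    refine ge_of_tendsto h1 ?_
    filter_upwards [self_mem_nhdsWithin] with r hr
    refine div_nonneg (integral_nonneg_of_ae ?_) (sq_nonneg _)
    filter_upwards [ae_circleDefect_realMaxPotential_nonneg h hr] with z hz
    exact mul_nonneg (hpos z) hz
  exact nonneg_of_mul_nonneg_right h2 (by have := Real.pi_pos; positivity)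

/-- The Riesz measure of the subharmonic function `max_k U_{μ_k}` is a probability measure. -/
theorem exists_isProbabilityMeasure_integral_eq {m : ℕ} [NeZero m] {μ : Fin m → Measure ℂ}
    [∀ k, IsProbabilityMeasure (μ k)] (h : ∀ k, IsCompact (μ k).support) :
    ∃ ρ : Measure ℂ, IsProbabilityMeasure ρ ∧ ∀ φ : ℂ → ℂ, IsTestFunction φ →
      ∫ z, φ z ∂ρ
        = (1 / (2 * π) : ℂ) * ∫ z, Laplacian.laplacian φ z * (realMaxPotential μ z : ℂ) := by
  have hV := locallyIntegrable_realMaxPotential h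
  obtain ⟨ρ, hreg, hρ⟩ := exists_measure_of_laplacian_nonneg hV fun ψ hψ hc hpos =>
    integral_laplacian_mul_realMaxPotential_nonneg h (hψ.of_le two_le_coe_top) hc hpos
  obtain ⟨S, hS0, hS⟩ := exists_forall_ae_norm_le h
  refine ⟨ρ, isProbabilityMeasure_of_tendsto_integral_cutoff ?_,
    fun φ hφ => integral_eq_of_forall_real hV hρ hφ⟩
  have hlim := (tendsto_integral_laplacian_cutoff_mul hV
    fun z hz => abs_realMaxPotential_sub_log_norm_le hS0 hS hz).const_mul (2 * π)⁻¹
  rw [inv_mul_cancel₀ Real.two_pi_pos.ne'] at hlim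
  exact hlim.congr fun n => (hρ _ (contDiff_cutoff _) (hasCompactSupport_cutoff (by positivity))).symm

lemma isDistribLaplacianOver2Pi_maxLogPotential_iff {m : ℕ} [NeZero m] {μ : Fin m → Measure ℂ}
    [∀ k, IsProbabilityMeasure (μ k)] (h : ∀ k, IsCompact (μ k).support) (ρ : Measure ℂ) :
    IsDistribLaplacianOver2Pi ρ (maxLogPotential μ) ↔ ∀ φ : ℂ → ℂ, IsTestFunction φ →
      ∫ z, φ z ∂ρ
        = (1 / (2 * π) : ℂ) * ∫ z, Laplacian.laplacian φ z * (realMaxPotential μ z : ℂ) := by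
  have hae := ae_maxLogPotential_eq h
  have hint : ∀ φ : ℂ → ℂ, ∫ z, Laplacian.laplacian φ z * ((maxLogPotential μ z).toReal : ℂ)
      = ∫ z, Laplacian.laplacian φ z * (realMaxPotential μ z : ℂ) := fun φ => by
    refine integral_congr_ae ?_
    filter_upwards [hae] with z hz
    rw [hz, EReal.toReal_coe]
  constructor
  · rintro ⟨-, -, h3⟩ φ hφ
    rw [h3 φ hφ, hint]
  · refine fun h3 => ⟨?_, ?_, fun φ hφ => by rw [h3 φ hφ, hint]⟩
    · filter_upwards [hae] with z hz
      rw [hz]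
      exact ⟨EReal.coe_ne_bot _, EReal.coe_ne_top _⟩
    · refine (locallyIntegrable_realMaxPotential h).congr ?_
      filter_upwards [hae] with z hz
      rw [hz, EReal.toReal_coe]

lemma measure_ext_of_integral_isTestFunction {ρ ρ' : Measure ℂ} [IsFiniteMeasureOnCompacts ρ]
    [IsFiniteMeasureOnCompacts ρ']
    (h : ∀ φ : ℂ → ℂ, IsTestFunction φ → ∫ z, φ z ∂ρ = ∫ z, φ z ∂ρ') : ρ = ρ' := by
  refine measure_ext_of_integral_contDiff fun ψ hψ hc => ?_
  have := h (fun z => (ψ z : ℂ)) ⟨Complex.ofRealCLM.contDiff.comp hψ,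
    hc.comp_left (g := Complex.ofReal) Complex.ofReal_zero⟩
  rw [integral_complex_ofReal, integral_complex_ofReal] at this
  exact_mod_cast this

/-! ### Anticoncentration of sums of independent random variables -/

lemma ae_exp_ne_exp {x y : ℝ} (hxy : x ≠ y) :
    ∀ᵐ t : ℝ, Complex.exp (t * x * Complex.I) ≠ Complex.exp (t * y * Complex.I) := by
  have hc : (Set.range fun n : ℤ => 2 * π * n / (x - y)).Countable := Set.countable_range _
  have h0 : ∀ᵐ t : ℝ, t ∉ Set.range fun n : ℤ => 2 * π * n / (x - y) :=
    measure_eq_zero_iff_ae_notMem.1 (hc.measure_zero volume)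
  filter_upwards [h0] with t ht heq
  obtain ⟨n, hn⟩ := Complex.exp_eq_exp_iff_exists_int.1 heq
  refine ht ⟨n, ?_⟩
  have hd : x - y ≠ 0 := sub_ne_zero.2 hxy
  have h1 : ((t * x : ℝ) : ℂ) = ((t * y + n * (2 * π) : ℝ) : ℂ) := by
    refine mul_right_cancel₀ Complex.I_ne_zero ?_
    push_cast
    rw [hn]
    ring
  have h2 : t * x = t * y + n * (2 * π) := Complex.ofReal_injective h1
  beta_reduce
  rw [div_eq_iff hd]
  linarith

/-- The characteristic function of a nondegenerate law has modulus less than one almost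
everywhere. -/
lemma ae_norm_charFun_lt_one {ν : Measure ℝ} [IsProbabilityMeasure ν]
    (h : ∀ c, ¬ ∀ᵐ x ∂ν, x = c) : ∀ᵐ t : ℝ, ‖charFun ν t‖ < 1 := by
  have hmeas : MeasurableSet {p : (ℝ × ℝ) × ℝ | p.1.1 ≠ p.1.2 →
      Complex.exp (p.2 * p.1.1 * Complex.I) ≠ Complex.exp (p.2 * p.1.2 * Complex.I)} := by
    have h1 : MeasurableSet {p : (ℝ × ℝ) × ℝ | p.1.1 = p.1.2} :=
      measurableSet_eq_fun (by fun_prop) (by fun_prop)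
    have h2 : MeasurableSet {p : (ℝ × ℝ) × ℝ |
        Complex.exp (p.2 * p.1.1 * Complex.I) = Complex.exp (p.2 * p.1.2 * Complex.I)} :=
      measurableSet_eq_fun (by fun_prop) (by fun_prop)
    convert h1.union h2.compl using 1
    ext p
    simp only [Set.mem_union, Set.mem_compl_iff]
    exact imp_iff_or_not.trans (by tauto)
  have h1 := (Measure.ae_ae_comm (μ := ν.prod ν) (ν := (volume : Measure ℝ))
    (p := fun q t => q.1 ≠ q.2 →
      Complex.exp (t * q.1 * Complex.I) ≠ Complex.exp (t * q.2 * Complex.I)) hmeas).1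
    (ae_of_all _ fun q => by
      by_cases hq : q.1 = q.2
      · exact ae_of_all _ fun t h => absurd hq h
      · filter_upwards [ae_exp_ne_exp hq] with t ht _ using ht)
  filter_upwards [h1] with t ht
  have hb : ∀ᵐ x : ℝ ∂ν, ‖Complex.exp (t * x * Complex.I)‖ ≤ 1 := ae_of_all _ fun x => by
    rw [← Complex.ofReal_mul, Complex.norm_exp_ofReal_mul_I]
  rcases ae_eq_const_or_norm_integral_lt_of_norm_le_const hb with hconst | hlt
  · exfalso
    have h2 : ∀ᵐ x : ℝ ∂ν, ∀ᵐ y : ℝ ∂ν, x ≠ y →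
        Complex.exp (t * x * Complex.I) ≠ Complex.exp (t * y * Complex.I) :=
      Measure.ae_ae_of_ae_prod ht
    obtain ⟨x, hx1, hx2⟩ := (h2.and hconst).exists
    refine h x ?_
    filter_upwards [hx1, hconst] with y hy1 hy2
    by_contra hne
    exact hy1 (Ne.symm hne) (hx2.trans hy2.symm)
  · rw [charFun_apply_real]
    simpa using hlt

/-- Gaussian smoothing bounds the probability that a random variable lies in `[-M, M]` by a
weighted integral of its characteristic function. -/
lemma measure_abs_le_le_integral_charFun {ν : Measure ℝ} [IsProbabilityMeasure ν] (M : ℝ) :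
    ν.real {x | |x| ≤ M}
      ≤ Real.exp (M ^ 2 / 2) * ∫ t, ‖charFun ν t‖ ∂(gaussianReal 0 1) := by
  have hexp : ∀ x : ℝ, charFun (gaussianReal 0 1) x = (Real.exp (-(x ^ 2 / 2)) : ℂ) := fun x => by
    rw [charFun_gaussianReal]
    push_cast
    simp
  have hmc : Measurable fun p : ℝ × ℝ => Complex.exp (p.1 * p.2 * Complex.I) := by fun_prop
  have hnorm : ∀ t x : ℝ, ‖Complex.exp (t * x * Complex.I)‖ = 1 := fun t x => by
    rw [← Complex.ofReal_mul, Complex.norm_exp_ofReal_mul_I]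
  have hint : Integrable (fun p : ℝ × ℝ => Complex.exp (p.1 * p.2 * Complex.I))
      ((gaussianReal 0 1).prod ν) :=
    Integrable.of_bound hmc.aestronglyMeasurable 1 (ae_of_all _ fun p => (hnorm p.1 p.2).le)
  have hfub : ∫ t, charFun ν t ∂(gaussianReal 0 1) = ((∫ x, Real.exp (-(x ^ 2 / 2)) ∂ν : ℝ) : ℂ) := by
    rw [← integral_complex_ofReal]
    simp_rw [← hexp, charFun_apply_real]
    rw [integral_integral_swap (f := fun t x : ℝ => Complex.exp (t * x * Complex.I)) hint]
    simp_rw [mul_comm]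
  have hgi : Integrable (fun x : ℝ => Real.exp (-(x ^ 2 / 2))) ν :=
    Integrable.of_bound (by fun_prop) 1 (ae_of_all _ fun x => by
      rw [Real.norm_eq_abs, abs_of_pos (Real.exp_pos _)]
      exact Real.exp_le_one_iff.2 (by linarith [sq_nonneg x]))
  have hms : MeasurableSet {x : ℝ | |x| ≤ M} := measurableSet_le (by fun_prop) (by fun_prop)
  have h1 : ν.real {x | |x| ≤ M} ≤ Real.exp (M ^ 2 / 2) * ∫ x, Real.exp (-(x ^ 2 / 2)) ∂ν := by
    rw [← integral_indicator_one hms, ← integral_const_mul]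
    refine integral_mono_of_nonneg (ae_of_all _ fun x => Set.indicator_nonneg (by simp) _)
      (hgi.const_mul _) (ae_of_all _ fun x => ?_)
    by_cases hx : |x| ≤ M
    · rw [Set.indicator_of_mem (by exact hx)]
      simp only [← Real.exp_add, Pi.one_apply]
      refine Real.one_le_exp ?_
      have : x ^ 2 ≤ M ^ 2 := by rw [← sq_abs]; gcongr
      linarith
    · rw [Set.indicator_of_notMem (by exact hx)]
      positivity
  have h2 : ∫ x, Real.exp (-(x ^ 2 / 2)) ∂ν ≤ ∫ t, ‖charFun ν t‖ ∂(gaussianReal 0 1) := by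
    have := norm_integral_le_integral_norm (μ := gaussianReal 0 1) (charFun ν)
    rw [hfub, Complex.norm_real] at this
    exact (le_abs_self _).trans this
  exact h1.trans (by gcongr)

/-- The difference of two independent random walks, one of which has nondegenerate steps, does not
concentrate on bounded intervals. -/
theorem tendsto_measure_abs_sum_sub_sum_le {Ω : Type*} [MeasurableSpace Ω] {P : Measure Ω}
    [IsProbabilityMeasure P] {m : ℕ} {Z : ℕ → Fin m → Ω → ℝ} (hZ : ∀ i k, Measurable (Z i k))
    (hind : iIndepFun (fun ik : ℕ × Fin m => Z ik.1 ik.2) P) {k l : Fin m} (hkl : k ≠ l)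
    {ν : Measure ℝ} (hlaw : ∀ i, P.map (Z i k) = ν) (hν : ∀ c, ¬ ∀ᵐ x ∂ν, x = c) (M : ℝ) :
    Tendsto (fun n : ℕ => P {ω | |∑ i ∈ Finset.range n, Z i k ω - ∑ i ∈ Finset.range n, Z i l ω|
      ≤ M}) atTop (𝓝 0) := by
  have hνp : IsProbabilityMeasure ν := by
    rw [← hlaw 0]
    exact Measure.isProbabilityMeasure_map (hZ 0 k).aemeasurable
  set g : ℕ × Fin m → ℝ → ℝ := fun q x => if q.2 = k then x else -x with hg
  have hgm : ∀ q, Measurable (g q) := fun q => by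
    by_cases hq : q.2 = k
    · simpa [hg, hq] using measurable_id'
    · simpa [hg, hq] using measurable_neg
  set W : ℕ × Fin m → Ω → ℝ := fun q => g q ∘ Z q.1 q.2 with hW
  have hWm : ∀ q, Measurable (W q) := fun q => (hgm q).comp (hZ _ _)
  have hWind : iIndepFun W P := hind.comp g hgm
  have hD : ∀ n ω, ∑ q ∈ Finset.range n ×ˢ ({k, l} : Finset (Fin m)), W q ω
      = ∑ i ∈ Finset.range n, Z i k ω - ∑ i ∈ Finset.range n, Z i l ω := fun n ω => by
    rw [Finset.sum_product, ← Finset.sum_sub_distrib]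
    refine Finset.sum_congr rfl fun i _ => ?_
    rw [Finset.sum_pair hkl]
    simp [hW, hg, hkl.symm, sub_eq_add_neg]
  have hDm : ∀ n, Measurable fun ω => ∑ q ∈ Finset.range n ×ˢ ({k, l} : Finset (Fin m)), W q ω :=
    fun n => Finset.measurable_fun_sum _ fun q _ => hWm q
  have hbound : ∀ n t, ‖charFun (P.map fun ω =>
      ∑ q ∈ Finset.range n ×ˢ ({k, l} : Finset (Fin m)), W q ω) t‖ ≤ ‖charFun ν t‖ ^ n := by
    intro n t
    rw [iIndepFun.charFun_map_fun_finsetSum_eq_prod (fun q _ => (hWm q).aemeasurable)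
      (iIndepFun.precomp (g := fun q : ↥(Finset.range n ×ˢ ({k, l} : Finset (Fin m))) =>
        (q : ℕ × Fin m)) Subtype.val_injective hWind), Finset.prod_apply, Finset.prod_product, norm_prod]
    have : ‖charFun ν t‖ ^ n = ∏ i ∈ Finset.range n, ‖charFun ν t‖ := by simp
    rw [this]
    refine Finset.prod_le_prod (fun _ _ => norm_nonneg _) fun i _ => ?_
    rw [Finset.prod_pair hkl, norm_mul]
    have h1 : W (i, k) = Z i k := by
      ext ω
      simp [hW, hg]
    have h2 : IsProbabilityMeasure (P.map (W (i, l))) :=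
      Measure.isProbabilityMeasure_map (hWm _).aemeasurable
    rw [h1, hlaw]
    exact mul_le_of_le_one_right (norm_nonneg _) (norm_charFun_le_one t)
  have hdom : Tendsto (fun n : ℕ => ∫ t, ‖charFun ν t‖ ^ n ∂(gaussianReal 0 1)) atTop (𝓝 0) := by
    have hm : Measurable (charFun ν) := measurable_charFun
    have := tendsto_integral_of_dominated_convergence (μ := gaussianReal 0 1)
      (F := fun (n : ℕ) t => ‖charFun ν t‖ ^ n) (f := fun _ => 0) (fun _ => (1 : ℝ))
      (fun n => (hm.norm.pow_const n).aestronglyMeasurable) (integrable_const _)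
      (fun n => ae_of_all _ fun t => by
        rw [norm_pow, norm_norm]
        exact pow_le_one₀ (norm_nonneg _) (norm_charFun_le_one t))
      (by
        filter_upwards [(gaussianReal_absolutelyContinuous 0 one_ne_zero).ae_le
          (ae_norm_charFun_lt_one hν)] with t ht
        exact tendsto_pow_atTop_nhds_zero_of_lt_one (norm_nonneg _) ht)
    simpa using this
  have hreal : Tendsto (fun n : ℕ => P.real {ω | |∑ i ∈ Finset.range n, Z i k ω
      - ∑ i ∈ Finset.range n, Z i l ω| ≤ M}) atTop (𝓝 0) := by
    have h0 := hdom.const_mul (Real.exp (M ^ 2 / 2))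
    rw [mul_zero] at h0
    refine squeeze_zero (fun _ => measureReal_nonneg) (fun n => ?_) h0
    have hp : IsProbabilityMeasure (P.map fun ω =>
      ∑ q ∈ Finset.range n ×ˢ ({k, l} : Finset (Fin m)), W q ω) :=
      Measure.isProbabilityMeasure_map (hDm n).aemeasurable
    have h1 := measure_abs_le_le_integral_charFun (ν := P.map fun ω =>
      ∑ q ∈ Finset.range n ×ˢ ({k, l} : Finset (Fin m)), W q ω) M
    rw [map_measureReal_apply (hDm n) (measurableSet_le (by fun_prop) (by fun_prop))] at h1
    simp only [Set.preimage_ofPred_eq, hD] at h1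
    refine h1.trans ?_
    have hmν : Measurable (charFun ν) := measurable_charFun
    refine mul_le_mul_of_nonneg_left ?_ (Real.exp_pos _).le
    refine integral_mono_of_nonneg (ae_of_all _ fun _ => norm_nonneg _) ?_
      (ae_of_all _ fun t => by simpa only [hD] using hbound n t)
    refine Integrable.of_bound (hmν.norm.pow_const n).aestronglyMeasurable 1
      (ae_of_all _ fun t => ?_)
    rw [norm_pow, norm_norm]
    exact pow_le_one₀ (norm_nonneg _) (norm_charFun_le_one t)
  rw [← ENNReal.tendsto_toReal_iff (fun _ => measure_ne_top _ _) ENNReal.zero_ne_top]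
  rw [ENNReal.toReal_zero]
  exact hreal

/-! ### Pointwise convergence of the potentials of the zeros -/

/-- If the moduli of nonzero numbers `p k` differ pairwise by factors larger than `2m`, then the
largest of them dominates their sum. -/
lemma abs_log_norm_sum_div_sub_iSup_le {m : ℕ} [NeZero m] {p : Fin m → ℂ} (hp : ∀ k, p k ≠ 0)
    (hsep : ∀ k l, k < l → Real.log (2 * m) < |Real.log ‖p k‖ - Real.log ‖p l‖|) :
    |Real.log ‖(∑ k, p k) / m‖ - ⨆ k, Real.log ‖p k‖| ≤ Real.log (2 * m) := by
  have hm : (0 : ℝ) < m := Nat.cast_pos.2 (NeZero.pos m)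
  obtain ⟨K, hK⟩ := exists_eq_ciSup_of_finite (f := fun k => Real.log ‖p k‖)
  have hmax : ∀ k, Real.log ‖p k‖ ≤ Real.log ‖p K‖ := fun k => by
    rw [hK]
    exact le_ciSup (f := fun k => Real.log ‖p k‖) (Set.finite_range _).bddAbove k
  have hpos : ∀ k, 0 < ‖p k‖ := fun k => norm_pos_iff.2 (hp k)
  have hle : ∀ k, ‖p k‖ ≤ ‖p K‖ := fun k => (Real.log_le_log_iff (hpos k) (hpos K)).1 (hmax k)
  have hsmall : ∀ k, k ≠ K → ‖p k‖ ≤ ‖p K‖ / (2 * m) := fun k hk => by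
    have h1 : Real.log (2 * m) < |Real.log ‖p k‖ - Real.log ‖p K‖| := by
      rcases lt_or_gt_of_ne hk with h | h
      · exact hsep k K h
      · rw [abs_sub_comm]
        exact hsep K k h
    rw [abs_of_nonpos (by linarith [hmax k])] at h1
    rw [← Real.log_le_log_iff (hpos k) (div_pos (hpos K) (by positivity)),
      Real.log_div (hpos K).ne' (by positivity)]
    linarith
  have hupper : ‖∑ k, p k‖ ≤ m * ‖p K‖ := by
    refine (norm_sum_le _ _).trans ((Finset.sum_le_sum fun k _ => hle k).trans_eq ?_)
    simp
  have hlower : ‖p K‖ / 2 ≤ ‖∑ k, p k‖ := by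
    rw [← Finset.add_sum_erase _ _ (Finset.mem_univ K)]
    have h1 : ‖∑ k ∈ Finset.univ.erase K, p k‖ ≤ ‖p K‖ / 2 := by
      calc ‖∑ k ∈ Finset.univ.erase K, p k‖
          ≤ ∑ k ∈ Finset.univ.erase K, ‖p K‖ / (2 * m) :=
            (norm_sum_le _ _).trans
              (Finset.sum_le_sum fun k hk => hsmall k (Finset.ne_of_mem_erase hk))
        _ ≤ ∑ k : Fin m, ‖p K‖ / (2 * m) :=
            Finset.sum_le_sum_of_subset_of_nonneg (Finset.subset_univ _) fun _ _ _ => by positivity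
        _ = ‖p K‖ / 2 := by
            simp
            field_simp
    have h2 := norm_sub_norm_le (p K) (-∑ k ∈ Finset.univ.erase K, p k)
    rw [norm_neg, sub_neg_eq_add] at h2
    linarith
  have hn : ‖(∑ k, p k) / m‖ = ‖∑ k, p k‖ / m := by simp
  have hs0 : 0 < ‖∑ k, p k‖ := lt_of_lt_of_le (half_pos (hpos K)) hlower
  have hlog0 : 0 ≤ Real.log (2 * m) := by
    refine Real.log_nonneg ?_
    have : (1 : ℝ) ≤ m := Nat.one_le_cast.2 (NeZero.pos m)
    linarith
  rw [← hK, hn, abs_le]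
  constructor
  · have : Real.log (‖p K‖ / (2 * m)) ≤ Real.log (‖∑ k, p k‖ / m) := by
      refine Real.log_le_log (div_pos (hpos K) (by positivity)) ?_
      rw [div_mul_eq_div_div]
      gcongr
    rw [Real.log_div (hpos K).ne' (by positivity)] at this
    linarith
  · have : Real.log (‖∑ k, p k‖ / m) ≤ Real.log ‖p K‖ := by
      refine Real.log_le_log (div_pos hs0 hm) ?_
      rw [div_le_iff₀ hm]
      linarith
    linarith

lemma abs_ciSup_sub_ciSup_le {m : ℕ} [NeZero m] {a b : Fin m → ℝ} {ε : ℝ}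
    (h : ∀ k, |a k - b k| ≤ ε) : |(⨆ k, a k) - ⨆ k, b k| ≤ ε := by
  have ha : ∀ k, a k ≤ ⨆ k, a k := le_ciSup (Set.finite_range a).bddAbove
  have hb : ∀ k, b k ≤ ⨆ k, b k := le_ciSup (Set.finite_range b).bddAbove
  rw [abs_le]
  constructor
  · have : ⨆ k, b k ≤ (⨆ k, a k) + ε :=
      ciSup_le fun k => by linarith [(abs_le.1 (h k)).1, ha k]
    linarith
  · have : ⨆ k, a k ≤ (⨆ k, b k) + ε :=
      ciSup_le fun k => by linarith [(abs_le.1 (h k)).2, hb k]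
    linarith

/-- The normalized sum `(1 / m) ∑_k ∏_{i < n} (z - x_{i,k})`, a monic polynomial in `z`. -/
noncomputable def meanPoly {m : ℕ} (x : ℕ → Fin m → ℂ) (n : ℕ) (z : ℂ) : ℂ :=
  (∑ k, ∏ i ∈ Finset.range n, (z - x i k)) / m

/-- The points `z` at which all `log ‖z - ·‖` are integrable and which are not atoms: almost every
point of the plane. -/
def IsRegularPoint {m : ℕ} (μ : Fin m → Measure ℂ) (z : ℂ) : Prop :=
  ∀ k, Integrable (fun w => Real.log ‖z - w‖) (μ k) ∧ ∀ᵐ w ∂μ k, z ≠ w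

lemma ae_isRegularPoint {m : ℕ} {μ : Fin m → Measure ℂ} [∀ k, IsFiniteMeasure (μ k)]
    (h : ∀ k, IsCompact (μ k).support) : ∀ᵐ z, IsRegularPoint μ z := by
  choose S _ hS using fun k => exists_ae_norm_le (h k)
  filter_upwards [ae_all_iff.2 fun k => ae_integrable_log_norm_sub (hS k),
    ae_all_iff.2 fun k => ae_ae_ne (μ k)] with z h1 h2 k
  exact ⟨h1 k, h2 k⟩

section Sampling

variable {Ω : Type*} [MeasurableSpace Ω] {P : Measure Ω} {m : ℕ}
  {μ : Fin m → Measure ℂ} {Y : ℕ → Fin m → Ω → ℂ}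

lemma measurable_log_norm_sub_comp (hY : ∀ i k, Measurable (Y i k)) (z : ℂ) (i : ℕ) (k : Fin m) :
    Measurable fun ω => Real.log ‖z - Y i k ω‖ := by
  have := hY i k
  fun_prop

lemma ae_tendsto_sum_log_div (hY : ∀ i k, Measurable (Y i k)) (hlaw : ∀ i k, P.map (Y i k) = μ k)
    (hind : iIndepFun (fun ik : ℕ × Fin m => Y ik.1 ik.2) P) {z : ℂ} {k : Fin m}
    (hz : Integrable (fun w => Real.log ‖z - w‖) (μ k)) :
    ∀ᵐ ω ∂P, Tendsto (fun n : ℕ => (∑ i ∈ Finset.range n, Real.log ‖z - Y i k ω‖) / n) atTop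
      (𝓝 (realPotential (μ k) z)) := by
  have hg : Measurable fun w : ℂ => Real.log ‖z - w‖ := by fun_prop
  have hmean : ∫ ω, Real.log ‖z - Y 0 k ω‖ ∂P = realPotential (μ k) z := by
    rw [realPotential, ← hlaw 0 k, integral_map (hY 0 k).aemeasurable hg.aestronglyMeasurable]
  rw [← hmean]
  refine strong_law_ae_real (fun i ω => Real.log ‖z - Y i k ω‖) ?_ ?_ ?_
  · rw [← hlaw 0 k] at hz
    exact hz.comp_measurable (hY 0 k)
  · intro i j hij
    have := hind.indepFun (i := (i, k)) (j := (j, k)) (by simpa using hij)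
    exact this.comp hg hg
  · intro i
    have : IdentDistrib (Y i k) (Y 0 k) P P :=
      ⟨(hY i k).aemeasurable, (hY 0 k).aemeasurable, by rw [hlaw, hlaw]⟩
    exact this.comp hg

variable [IsProbabilityMeasure P]

lemma tendstoInMeasure_sum_log_div (hY : ∀ i k, Measurable (Y i k))
    (hlaw : ∀ i k, P.map (Y i k) = μ k)
    (hind : iIndepFun (fun ik : ℕ × Fin m => Y ik.1 ik.2) P) {z : ℂ} {k : Fin m}
    (hz : Integrable (fun w => Real.log ‖z - w‖) (μ k)) {ε : ℝ} (hε : 0 < ε) :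
    Tendsto (fun n : ℕ => P {ω | ε ≤ |(∑ i ∈ Finset.range n, Real.log ‖z - Y i k ω‖) / n
      - realPotential (μ k) z|}) atTop (𝓝 0) := by
  have hm : ∀ n : ℕ, Measurable fun ω => (∑ i ∈ Finset.range n, Real.log ‖z - Y i k ω‖) / n :=
    fun n => (Finset.measurable_fun_sum _ fun i _ =>
      measurable_log_norm_sub_comp hY z i k).div_const _
  have := tendstoInMeasure_of_tendsto_ae (fun n => (hm n).aestronglyMeasurable)
    (ae_tendsto_sum_log_div hY hlaw hind hz)
  exact tendstoInMeasure_iff_norm.1 this ε hε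

/-- At points where two potentials differ, the corresponding random products differ in modulus by
exponential factors. -/
lemma tendsto_measure_of_realPotential_ne (hY : ∀ i k, Measurable (Y i k))
    (hlaw : ∀ i k, P.map (Y i k) = μ k)
    (hind : iIndepFun (fun ik : ℕ × Fin m => Y ik.1 ik.2) P) {z : ℂ} (hz : IsRegularPoint μ z)
    {k l : Fin m} (hne : realPotential (μ k) z ≠ realPotential (μ l) z) (M : ℝ) :
    Tendsto (fun n : ℕ => P {ω | |∑ i ∈ Finset.range n, Real.log ‖z - Y i k ω‖
      - ∑ i ∈ Finset.range n, Real.log ‖z - Y i l ω‖| ≤ M}) atTop (𝓝 0) := by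
  set d := |realPotential (μ k) z - realPotential (μ l) z| with hd
  have hd0 : 0 < d := abs_pos.2 (sub_ne_zero.2 hne)
  have h1 := (tendstoInMeasure_sum_log_div hY hlaw hind (hz k).1 (ε := d / 4) (by positivity)).add
    (tendstoInMeasure_sum_log_div hY hlaw hind (hz l).1 (ε := d / 4) (by positivity))
  rw [add_zero] at h1
  refine tendsto_of_tendsto_of_tendsto_of_le_of_le' tendsto_const_nhds h1
    (Eventually.of_forall fun _ => zero_le) ?_
  filter_upwards [tendsto_natCast_atTop_atTop.eventually_gt_atTop (M / (d / 2)),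
    eventually_gt_atTop 0] with n hn hn0
  refine (measure_mono fun ω hω => ?_).trans (measure_union_le _ _)
  have hω' : |∑ i ∈ Finset.range n, Real.log ‖z - Y i k ω‖
      - ∑ i ∈ Finset.range n, Real.log ‖z - Y i l ω‖| ≤ M := hω
  have hnR : (0 : ℝ) < n := Nat.cast_pos.2 hn0
  by_contra hcon
  rw [Set.mem_union, not_or] at hcon
  set A := ∑ i ∈ Finset.range n, Real.log ‖z - Y i k ω‖
  set B := ∑ i ∈ Finset.range n, Real.log ‖z - Y i l ω‖
  have hc1 : |A / n - realPotential (μ k) z| < d / 4 := not_le.1 fun h => hcon.1 h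
  have hc2 : |B / n - realPotential (μ l) z| < d / 4 := not_le.1 fun h => hcon.2 h
  have hAB : |A / n - B / n| ≤ M / n := by
    rw [← sub_div, abs_div, abs_of_pos hnR]
    gcongr
  have hMn : M / n < d / 2 := by
    rw [div_lt_iff₀ (by positivity)] at hn
    rw [div_lt_iff₀ hnR]
    linarith
  have htri : d ≤ |A / n - realPotential (μ k) z| + |A / n - B / n|
      + |B / n - realPotential (μ l) z| := by
    rw [hd]
    have e : realPotential (μ k) z - realPotential (μ l) z
        = -(A / n - realPotential (μ k) z) + (A / n - B / n)
          + (B / n - realPotential (μ l) z) := by ring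
    rw [e]
    refine (abs_add_le _ _).trans ?_
    gcongr
    refine (abs_add_le _ _).trans ?_
    rw [abs_neg]
  linarith

lemma not_ae_log_norm_sub_eq_const {ν : Measure ℂ} {K : Set ℂ}
    (hν : ¬ SupportedOnCircleCenteredIn ν K) {z : ℂ} (hzK : z ∈ K) (hz : ∀ᵐ w ∂ν, z ≠ w) (c : ℝ) :
    ¬ ∀ᵐ w ∂ν, Real.log ‖z - w‖ = c := by
  intro hc
  refine hν ⟨Real.exp c, (Real.exp_pos c).le, z, hzK, ?_⟩
  refine Measure.support_subset_of_isClosed ?_ ?_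
  · exact isClosed_eq (by fun_prop) continuous_const
  · filter_upwards [hc, hz] with w h1 h2
    rw [← h1, Real.exp_log (norm_pos_iff.2 (sub_ne_zero.2 h2)), norm_sub_rev]

/-- If `μ k` is not carried by a circle around `z`, then the random products of index `k` and `l`
are comparable at `z` with vanishing probability. -/
lemma tendsto_measure_of_not_supportedOnCircle (hY : ∀ i k, Measurable (Y i k))
    (hlaw : ∀ i k, P.map (Y i k) = μ k)
    (hind : iIndepFun (fun ik : ℕ × Fin m => Y ik.1 ik.2) P) {z : ℂ} (hz : IsRegularPoint μ z)
    {K : Set ℂ} (hzK : z ∈ K) {k l : Fin m} (hkl : k ≠ l)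
    (hk : ¬ SupportedOnCircleCenteredIn (μ k) K) (M : ℝ) :
    Tendsto (fun n : ℕ => P {ω | |∑ i ∈ Finset.range n, Real.log ‖z - Y i k ω‖
      - ∑ i ∈ Finset.range n, Real.log ‖z - Y i l ω‖| ≤ M}) atTop (𝓝 0) := by
  have hg : Measurable fun w : ℂ => Real.log ‖z - w‖ := by fun_prop
  refine tendsto_measure_abs_sum_sub_sum_le (Z := fun i k ω => Real.log ‖z - Y i k ω‖)
    (measurable_log_norm_sub_comp hY z) (hind.comp (fun _ w => Real.log ‖z - w‖) fun _ => hg) hkl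
    (ν := (μ k).map fun w => Real.log ‖z - w‖) (fun i => ?_) (fun c hc => ?_) M
  · rw [← hlaw i k, Measure.map_map hg (hY i k)]
    rfl
  · exact not_ae_log_norm_sub_eq_const hk hzK (hz k).2 c (ae_of_ae_map hg.aemeasurable hc)

/-- If the random products separate at a regular point `z`, then
`(1 / n) log ‖(1 / m) ∑_k p_{n,k}(z)‖` converges in probability to the maximum of the
potentials. -/
theorem tendsto_measure_log_meanPoly [NeZero m] (hY : ∀ i k, Measurable (Y i k))
    (hlaw : ∀ i k, P.map (Y i k) = μ k)
    (hind : iIndepFun (fun ik : ℕ × Fin m => Y ik.1 ik.2) P) {z : ℂ} (hz : IsRegularPoint μ z)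
    (hsep : ∀ k l, k < l → ∀ M : ℝ, Tendsto (fun n : ℕ =>
      P {ω | |∑ i ∈ Finset.range n, Real.log ‖z - Y i k ω‖
        - ∑ i ∈ Finset.range n, Real.log ‖z - Y i l ω‖| ≤ M}) atTop (𝓝 0))
    {ε : ℝ} (hε : 0 < ε) :
    Tendsto (fun n : ℕ => P {ω | ε ≤ |Real.log ‖meanPoly (fun i k => Y i k ω) n z‖ / n
      - realMaxPotential μ z|}) atTop (𝓝 0) := by
  set bad : ℕ → Fin m × Fin m → Set Ω := fun n q => {ω | q.1 < q.2 ∧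
    |∑ i ∈ Finset.range n, Real.log ‖z - Y i q.1 ω‖
      - ∑ i ∈ Finset.range n, Real.log ‖z - Y i q.2 ω‖| ≤ Real.log (2 * m)} with hbad
  set far : ℕ → Fin m → Set Ω := fun n k => {ω | ε / 2 ≤
    |(∑ i ∈ Finset.range n, Real.log ‖z - Y i k ω‖) / n - realPotential (μ k) z|} with hfar
  have hbadlim : ∀ q, Tendsto (fun n => P (bad n q)) atTop (𝓝 0) := fun q => by
    by_cases hq : q.1 < q.2
    · simpa [hbad, hq] using hsep q.1 q.2 hq (Real.log (2 * m))
    · simp [hbad, hq]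
  have hlim : Tendsto (fun n => ∑ q, P (bad n q) + ∑ k, P (far n k)) atTop (𝓝 0) := by
    have h1 := tendsto_finsetSum Finset.univ fun q _ => hbadlim q
    have h2 := tendsto_finsetSum Finset.univ fun k (_ : k ∈ Finset.univ) =>
      tendstoInMeasure_sum_log_div hY hlaw hind (hz k).1 (half_pos hε)
    simpa using h1.add h2
  have hne : ∀ᵐ ω ∂P, ∀ i k, z ≠ Y i k ω := by
    rw [ae_all_iff]
    intro i
    rw [ae_all_iff]
    intro k
    have := (hz k).2
    rw [← hlaw i k] at this
    exact ae_of_ae_map (hY i k).aemeasurable this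
  refine tendsto_of_tendsto_of_tendsto_of_le_of_le' tendsto_const_nhds hlim
    (Eventually.of_forall fun _ => zero_le) ?_
  filter_upwards [tendsto_natCast_atTop_atTop.eventually_gt_atTop (Real.log (2 * m) / (ε / 2)),
    eventually_gt_atTop 0] with n hn hn0
  have hnR : (0 : ℝ) < n := Nat.cast_pos.2 hn0
  have hcover : {ω | ε ≤ |Real.log ‖meanPoly (fun i k => Y i k ω) n z‖ / n
      - realMaxPotential μ z|} ≤ᵐ[P] ((⋃ q, bad n q) ∪ ⋃ k, far n k : Set Ω) := by
    filter_upwards [hne] with ω hω hmem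
    have hmem' : ε ≤ |Real.log ‖meanPoly (fun i k => Y i k ω) n z‖ / n
      - realMaxPotential μ z| := hmem
    by_contra hcon
    have hcon' : ω ∉ ((⋃ q, bad n q) ∪ ⋃ k, far n k : Set Ω) := hcon
    rw [Set.mem_union, not_or, Set.mem_iUnion, Set.mem_iUnion, not_exists, not_exists] at hcon'
    obtain ⟨hc1, hc2⟩ := hcon'
    set p : Fin m → ℂ := fun k => ∏ i ∈ Finset.range n, (z - Y i k ω) with hp
    have hp0 : ∀ k, p k ≠ 0 := fun k => Finset.prod_ne_zero_iff.2 fun i _ => sub_ne_zero.2 (hω i k)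
    have hlogp : ∀ k, Real.log ‖p k‖ = ∑ i ∈ Finset.range n, Real.log ‖z - Y i k ω‖ := fun k => by
      rw [hp, norm_prod, Real.log_prod fun i _ => norm_ne_zero_iff.2 (sub_ne_zero.2 (hω i k))]
    have h1 := abs_log_norm_sum_div_sub_iSup_le hp0 fun k l hkl => by
      rw [hlogp, hlogp]
      by_contra hle
      exact hc1 (k, l) ⟨hkl, not_lt.1 hle⟩
    have h2 : |(⨆ k, Real.log ‖p k‖ / n) - realMaxPotential μ z| ≤ ε / 2 := by
      refine abs_ciSup_sub_ciSup_le fun k => ?_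
      rw [hlogp]
      exact (not_le.1 (hc2 k)).le
    have h3 : (⨆ k, Real.log ‖p k‖) / n = ⨆ k, Real.log ‖p k‖ / n := by
      simp_rw [div_eq_mul_inv]
      exact Real.iSup_mul_of_nonneg (inv_nonneg.2 hnR.le) _
    have h4 : |Real.log ‖(∑ k, p k) / m‖ / n - ⨆ k, Real.log ‖p k‖ / n| < ε / 2 := by
      rw [← h3, ← sub_div, abs_div, abs_of_pos hnR, div_lt_iff₀ hnR]
      rw [div_lt_iff₀ (by positivity)] at hn
      linarith
    have h5 := abs_sub_le (Real.log ‖(∑ k, p k) / m‖ / n) (⨆ k, Real.log ‖p k‖ / n)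
      (realMaxPotential μ z)
    have h6 : meanPoly (fun i k => Y i k ω) n z = (∑ k, p k) / m := rfl
    rw [h6] at hmem'
    linarith
  calc P {ω | ε ≤ |Real.log ‖meanPoly (fun i k => Y i k ω) n z‖ / n - realMaxPotential μ z|}
      ≤ P ((⋃ q, bad n q) ∪ ⋃ k, far n k) := measure_mono_ae hcover
    _ ≤ P (⋃ q, bad n q) + P (⋃ k, far n k) := measure_union_le _ _
    _ ≤ ∑ q, P (bad n q) + ∑ k, P (far n k) :=
        add_le_add (measure_iUnion_fintype_le _ _) (measure_iUnion_fintype_le _ _)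

end Sampling

/-- Letting `n → ∞` in the separation assumption, the potentials agree only on a null set. -/
lemma ae_realPotential_ne_of_potentialsSeparatedOn {μ ν : Measure ℂ} [IsFiniteMeasure μ]
    [IsFiniteMeasure ν] (hμ : IsCompact μ.support) (hν : IsCompact ν.support) {K : Set ℂ}
    (h : PotentialsSeparatedOn μ ν K) :
    ∀ᵐ z, z ∈ K → realPotential μ z ≠ realPotential ν z := by
  obtain ⟨C, hC, hsep⟩ := h
  have hlim : Tendsto (fun n : ℕ => ENNReal.ofReal (C / Real.log n ^ 3)) atTop (𝓝 0) := by
    rw [← ENNReal.ofReal_zero]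
    refine ENNReal.tendsto_ofReal (Tendsto.const_div_atTop ?_ C)
    exact (tendsto_pow_atTop (by norm_num)).comp
      (Real.tendsto_log_atTop.comp tendsto_natCast_atTop_atTop)
  have hnull : volume {z ∈ K | logPotential μ z - logPotential ν z = 0} = 0 := by
    refine le_antisymm (ge_of_tendsto hlim ?_) zero_le
    filter_upwards [tendsto_natCast_atTop_atTop.eventually_gt_atTop C] with n hn
    refine (measure_mono ?_).trans (hsep n hn)
    rintro z ⟨hzK, hz⟩
    refine ⟨hzK, ?_⟩
    rw [hz]
    simp
  filter_upwards [measure_eq_zero_iff_ae_notMem.1 hnull, ae_logPotential_eq hμ,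
    ae_logPotential_eq hν] with z h1 h2 h3 hzK heq
  refine h1 ⟨hzK, ?_⟩
  rw [h2, h3, heq, ← EReal.coe_sub, sub_self, EReal.coe_zero]

/-! ### Square integrability of the normalized potentials of the zeros -/

lemma natDegree_sum_rootPoly {m : ℕ} [NeZero m] (x : ℕ → Fin m → ℂ) (n : ℕ) :
    (∑ k, rootPoly (fun i => x i k) n).natDegree = n ∧
      (∑ k, rootPoly (fun i => x i k) n).leadingCoeff = m := by
  have hdeg : ∀ k, (rootPoly (fun i => x i k) n).natDegree = n := fun k => by
    simp [rootPoly, natDegree_finsetProd_X_sub_C_eq_card]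
  have hcoeff : (∑ k, rootPoly (fun i => x i k) n).coeff n = m := by
    rw [finsetSum_coeff]
    have : ∀ k, (rootPoly (fun i => x i k) n).coeff n = 1 := fun k => by
      have := (monic_prod_X_sub_C (fun i => x i k) (Finset.range n)).coeff_natDegree
      rwa [← rootPoly, hdeg k] at this
    simp [this]
  have hm : (m : ℂ) ≠ 0 := Nat.cast_ne_zero.2 (NeZero.ne m)
  have h1 : (∑ k, rootPoly (fun i => x i k) n).natDegree = n :=
    natDegree_eq_of_le_of_coeff_ne_zero
      (natDegree_sum_le_of_forall_le _ _ fun k _ => (hdeg k).le) (by rwa [hcoeff])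
  exact ⟨h1, by rw [leadingCoeff, h1, hcoeff]⟩

/-- An enumeration of the zeros of `∑_k p_{n,k}`. -/
lemma exists_roots_sum_rootPoly {m : ℕ} [NeZero m] (x : ℕ → Fin m → ℂ) (n : ℕ) :
    ∃ b : Fin n → ℂ, (∀ z, meanPoly x n z = ∏ j, (z - b j)) ∧
      ∀ φ : ℂ → ℂ, rootAverage φ (∑ k, rootPoly (fun i => x i k) n) n
        = (1 / n : ℂ) * ∑ j, φ (b j) := by
  set p := ∑ k, rootPoly (fun i => x i k) n with hp
  obtain ⟨h1, h2⟩ := natDegree_sum_rootPoly x n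
  have hs : p.Splits := IsAlgClosed.splits p
  have hcard : p.roots.toList.length = n := by
    rw [Multiset.length_toList, ← hs.natDegree_eq_card_roots, h1]
  have hm : (m : ℂ) ≠ 0 := Nat.cast_ne_zero.2 (NeZero.ne m)
  have hb : ∃ b : Fin n → ℂ, p.roots = Finset.univ.val.map b := by
    refine ⟨fun j => p.roots.toList.get (Fin.cast hcard.symm j), ?_⟩
    rw [Fin.univ_val_map]
    conv_lhs => rw [← Multiset.coe_toList p.roots]
    congr 1
    refine List.ext_getElem (by simp [hcard]) fun j h _ => ?_
    simp
  obtain ⟨b, hb⟩ := hb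
  refine ⟨b, fun z => ?_, fun φ => ?_⟩
  · have heval : p.eval z = ∑ k, ∏ i ∈ Finset.range n, (z - x i k) := by
      simp [hp, rootPoly, eval_finsetSum, eval_prod]
    have hprod : p.eval z = m * ∏ j, (z - b j) := by
      rw [hs.eq_prod_roots, h2, hb, Multiset.map_map, eval_mul, eval_C]
      congr 1
      exact (eval_prod _ _ _).trans (by simp)
    rw [meanPoly, ← heval, hprod, mul_div_cancel_left₀ _ hm]
  · rw [rootAverage, hb, Multiset.map_map]
    rfl

lemma norm_meanPoly_le {m : ℕ} [NeZero m] {x : ℕ → Fin m → ℂ} {R S : ℝ} {z : ℂ} (hz : ‖z‖ ≤ R)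
    (hx : ∀ i k, ‖x i k‖ ≤ S) (n : ℕ) : ‖meanPoly x n z‖ ≤ (R + S) ^ n := by
  have hm : (0 : ℝ) < m := Nat.cast_pos.2 (NeZero.pos m)
  have h1 : ∀ k, ‖∏ i ∈ Finset.range n, (z - x i k)‖ ≤ (R + S) ^ n := fun k => by
    rw [norm_prod]
    refine (Finset.prod_le_prod (fun _ _ => norm_nonneg _) fun i _ =>
      (norm_sub_le _ _).trans (add_le_add hz (hx i k))).trans_eq ?_
    simp
  rw [meanPoly, norm_div, Complex.norm_natCast, div_le_iff₀ hm]
  refine (norm_sum_le _ _).trans ((Finset.sum_le_sum fun k _ => h1 k).trans_eq ?_)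
  simp [mul_comm]

/-- The normalized potential of the zeros `b j` is bounded above by a constant `B`, and its negative
part is at most the average of the functions `log⁻ ‖z - b j‖`. Hence so is its positive part, up to
the constant, wherever the zeros lie. -/
lemma abs_log_meanPoly_div_le {m : ℕ} [NeZero m] {x : ℕ → Fin m → ℂ} {R S : ℝ} {z : ℂ}
    (hz : ‖z‖ ≤ R) (hx : ∀ i k, ‖x i k‖ ≤ S) {n : ℕ} (hn : 0 < n) {b : Fin n → ℂ}
    (hb : ∀ z, meanPoly x n z = ∏ j, (z - b j)) :
    |Real.log ‖meanPoly x n z‖ / n|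
      ≤ Real.posLog (R + S) + 2 * ((∑ j, Real.posLog ‖z - b j‖⁻¹) / n) := by
  have hnR : (0 : ℝ) < n := Nat.cast_pos.2 hn
  have hN0 : 0 ≤ (∑ j, Real.posLog ‖z - b j‖⁻¹) / n :=
    div_nonneg (Finset.sum_nonneg fun _ _ => Real.posLog_nonneg) hnR.le
  have hB0 : 0 ≤ Real.posLog (R + S) := Real.posLog_nonneg
  by_cases h0 : meanPoly x n z = 0
  · simp only [h0, norm_zero, Real.log_zero, zero_div, abs_zero]
    positivity
  have hj : ∀ j, z - b j ≠ 0 := fun j => by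
    rw [hb] at h0
    exact Finset.prod_ne_zero_iff.1 h0 j (Finset.mem_univ j)
  have hlower : -(∑ j, Real.posLog ‖z - b j‖⁻¹) ≤ Real.log ‖meanPoly x n z‖ := by
    rw [hb, norm_prod, Real.log_prod fun j _ => norm_ne_zero_iff.2 (hj j), ← Finset.sum_neg_distrib]
    refine Finset.sum_le_sum fun j _ => ?_
    have h1 := Real.posLog_sub_posLog_inv (x := ‖z - b j‖)
    have h2 : 0 ≤ Real.posLog ‖z - b j‖ := Real.posLog_nonneg
    linarith
  have hupper : Real.log ‖meanPoly x n z‖ ≤ n * Real.posLog (R + S) := by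
    refine (Real.log_le_log (norm_pos_iff.2 h0) (norm_meanPoly_le hz hx n)).trans ?_
    rw [Real.log_pow]
    gcongr
    exact le_max_right _ _
  have h1 : -((∑ j, Real.posLog ‖z - b j‖⁻¹) / n) ≤ Real.log ‖meanPoly x n z‖ / n := by
    rw [← neg_div]
    gcongr
  have h2 : Real.log ‖meanPoly x n z‖ / n ≤ Real.posLog (R + S) := by
    rw [div_le_iff₀ hnR]
    linarith
  rw [abs_le]
  constructor <;> linarith

/-- The normalized potentials of the zeros are bounded in `L²` of every disc, by a constant that
depends neither on `n` nor on the sample. -/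
lemma lintegral_sq_log_meanPoly_div_le {m : ℕ} [NeZero m] {x : ℕ → Fin m → ℂ} {R S : ℝ}
    (hx : ∀ i k, ‖x i k‖ ≤ S) {n : ℕ} (hn : 0 < n) :
    ∫⁻ z in Metric.closedBall 0 R, ENNReal.ofReal ((Real.log ‖meanPoly x n z‖ / n) ^ 2)
      ≤ ENNReal.ofReal (2 * Real.posLog (R + S) ^ 2) * volume (Metric.closedBall (0 : ℂ) R)
        + ENNReal.ofReal 8 * ∫⁻ z : ℂ, ENNReal.ofReal (Real.posLog ‖z‖⁻¹ ^ 2) := by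
  obtain ⟨b, hb, -⟩ := exists_roots_sum_rootPoly x n
  have hnR : (0 : ℝ) < n := Nat.cast_pos.2 hn
  have hmN : ∀ j, Measurable fun z : ℂ => ENNReal.ofReal (Real.posLog ‖z - b j‖⁻¹ ^ 2) := fun j => by
    have := measurable_posLog
    fun_prop
  have hpt : ∀ z ∈ Metric.closedBall (0 : ℂ) R,
      ENNReal.ofReal ((Real.log ‖meanPoly x n z‖ / n) ^ 2)
        ≤ ENNReal.ofReal (2 * Real.posLog (R + S) ^ 2) + ENNReal.ofReal 8 * (ENNReal.ofReal (1 / n)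
          * ∑ j, ENNReal.ofReal (Real.posLog ‖z - b j‖⁻¹ ^ 2)) := by
    intro z hz
    have h1 := abs_log_meanPoly_div_le (mem_closedBall_zero_iff.1 hz) hx hn hb
    set N := (∑ j, Real.posLog ‖z - b j‖⁻¹) / n
    have hN : N ^ 2 ≤ 1 / n * ∑ j, Real.posLog ‖z - b j‖⁻¹ ^ 2 := by
      have := sq_sum_le_card_mul_sum_sq (s := Finset.univ) (f := fun j => Real.posLog ‖z - b j‖⁻¹)
      rw [Finset.card_univ, Fintype.card_fin] at this
      rw [div_pow, div_le_iff₀ (by positivity)]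
      refine this.trans_eq ?_
      field_simp
    rw [← ENNReal.ofReal_sum_of_nonneg fun _ _ => sq_nonneg _,
      ← ENNReal.ofReal_mul (by positivity), ← ENNReal.ofReal_mul (by positivity),
      ← ENNReal.ofReal_add (by positivity)
        (mul_nonneg (by norm_num) ((sq_nonneg N).trans hN))]
    refine ENNReal.ofReal_le_ofReal ?_
    have h2 : (Real.log ‖meanPoly x n z‖ / n) ^ 2 ≤ (Real.posLog (R + S) + 2 * N) ^ 2 := by
      rw [← sq_abs]
      gcongr
    nlinarith [sq_nonneg (Real.posLog (R + S) - 2 * N)]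
  calc ∫⁻ z in Metric.closedBall 0 R, ENNReal.ofReal ((Real.log ‖meanPoly x n z‖ / n) ^ 2)
      ≤ ∫⁻ z in Metric.closedBall 0 R, (ENNReal.ofReal (2 * Real.posLog (R + S) ^ 2)
        + ENNReal.ofReal 8 * (ENNReal.ofReal (1 / n)
          * ∑ j, ENNReal.ofReal (Real.posLog ‖z - b j‖⁻¹ ^ 2))) :=
        setLIntegral_mono' measurableSet_closedBall hpt
    _ = ENNReal.ofReal (2 * Real.posLog (R + S) ^ 2) * volume (Metric.closedBall (0 : ℂ) R)
        + ENNReal.ofReal 8 * (ENNReal.ofReal (1 / n) * ∑ j, ∫⁻ z in Metric.closedBall 0 R,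
          ENNReal.ofReal (Real.posLog ‖z - b j‖⁻¹ ^ 2)) := by
        rw [lintegral_add_left measurable_const, lintegral_const_mul, lintegral_const_mul,
          lintegral_finsetSum _ fun j _ => hmN j, lintegral_const, Measure.restrict_apply_univ]
        · exact Finset.measurable_fun_sum _ fun j _ => hmN j
        · exact (Finset.measurable_fun_sum _ fun j _ => hmN j).const_mul _
    _ ≤ ENNReal.ofReal (2 * Real.posLog (R + S) ^ 2) * volume (Metric.closedBall (0 : ℂ) R)
        + ENNReal.ofReal 8 * (ENNReal.ofReal (1 / n) * ∑ j : Fin n,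
          ∫⁻ z : ℂ, ENNReal.ofReal (Real.posLog ‖z‖⁻¹ ^ 2)) := by
        have hj : ∀ j, ∫⁻ z in Metric.closedBall 0 R, ENNReal.ofReal (Real.posLog ‖z - b j‖⁻¹ ^ 2)
            ≤ ∫⁻ z : ℂ, ENNReal.ofReal (Real.posLog ‖z‖⁻¹ ^ 2) := fun j =>
          (setLIntegral_le_lintegral _ _).trans_eq (lintegral_sub_right_eq_self
            (fun z : ℂ => ENNReal.ofReal (Real.posLog ‖z‖⁻¹ ^ 2)) (b j))
        exact add_le_add le_rfl (mul_le_mul' le_rfl (mul_le_mul' le_rfl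
          (Finset.sum_le_sum fun j _ => hj j)))
    _ = _ := by
        rw [Finset.sum_const, Finset.card_univ, Fintype.card_fin, nsmul_eq_mul, ← mul_assoc
          (ENNReal.ofReal (1 / n)), ← ENNReal.ofReal_natCast, ← ENNReal.ofReal_mul (by positivity),
          one_div_mul_cancel hnR.ne', ENNReal.ofReal_one, one_mul]

lemma IsTestFunction.exists_norm_laplacian_le {φ : ℂ → ℂ} (hφ : IsTestFunction φ) :
    ∃ D : ℝ, 0 < D ∧ ∀ z, ‖Laplacian.laplacian φ z‖ ≤ D := by
  obtain ⟨hr, hrc⟩ := hφ.re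
  obtain ⟨hi, hic⟩ := hφ.im
  obtain ⟨D₁, h1⟩ := (hasCompactSupport_laplacian hrc).exists_bound_of_continuous
    (continuous_laplacian (hr.of_le two_le_coe_top))
  obtain ⟨D₂, h2⟩ := (hasCompactSupport_laplacian hic).exists_bound_of_continuous
    (continuous_laplacian (hi.of_le two_le_coe_top))
  have h10 := (norm_nonneg _).trans (h1 0)
  have h20 := (norm_nonneg _).trans (h2 0)
  refine ⟨D₁ + D₂ + 1, by linarith, fun z => ?_⟩
  rw [laplacian_eq_re_add_im hφ]
  refine (norm_add_le _ _).trans ?_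
  rw [norm_mul, Complex.norm_I, mul_one, Complex.norm_real, Complex.norm_real]
  linarith [h1 z, h2 z]

lemma IsTestFunction.integrable_laplacian_mul {φ : ℂ → ℂ} (hφ : IsTestFunction φ) {V : ℂ → ℝ}
    (hV : LocallyIntegrable V) : Integrable fun z => Laplacian.laplacian φ z * (V z : ℂ) := by
  obtain ⟨hr, hrc⟩ := hφ.re
  obtain ⟨hi, hic⟩ := hφ.im
  refine ((_root_.integrable_laplacian_mul (hr.of_le two_le_coe_top) hrc hV).ofReal.add
    ((_root_.integrable_laplacian_mul (hi.of_le two_le_coe_top) hic hV).ofReal.mul_const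
      Complex.I)).congr (ae_of_all _ fun z => ?_)
  change ((Laplacian.laplacian (fun z => (φ z).re) z * V z : ℝ) : ℂ)
    + ((Laplacian.laplacian (fun z => (φ z).im) z * V z : ℝ) : ℂ) * Complex.I = Laplacian.laplacian φ z * (V z : ℂ)
  rw [laplacian_eq_re_add_im hφ]
  push_cast
  ring

lemma ae_log_norm_prod_eq {n : ℕ} (b : Fin n → ℂ) :
    ∀ᵐ z : ℂ, Real.log ‖∏ j, (z - b j)‖ = ∑ j, Real.log ‖z - b j‖ := by
  have h : ∀ j, ∀ᵐ z : ℂ, z ≠ b j := fun j => by simp [ae_iff]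
  filter_upwards [ae_all_iff.2 h] with z hz
  rw [norm_prod, Real.log_prod fun j _ => norm_ne_zero_iff.2 (sub_ne_zero.2 (hz j))]

/-- The average of a test function over the zeros is obtained by testing the normalized potential of
the zeros against its Laplacian. -/
lemma rootAverage_eq_integral_laplacian {m : ℕ} [NeZero m] (x : ℕ → Fin m → ℂ) (n : ℕ)
    {φ : ℂ → ℂ} (hφ : IsTestFunction φ) :
    Integrable (fun z => Laplacian.laplacian φ z * ((Real.log ‖meanPoly x n z‖ / n : ℝ) : ℂ)) ∧
    rootAverage φ (∑ k, rootPoly (fun i => x i k) n) n = (1 / (2 * π) : ℂ) *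
      ∫ z, Laplacian.laplacian φ z * ((Real.log ‖meanPoly x n z‖ / n : ℝ) : ℂ) := by
  obtain ⟨b, hb, havg⟩ := exists_roots_sum_rootPoly x n
  have hi : ∀ j, Integrable fun z => Laplacian.laplacian φ z * (Real.log ‖z - b j‖ : ℂ) := fun j =>
    hφ.integrable_laplacian_mul (locallyIntegrable_log_norm_sub (b j))
  have hae : ∀ᵐ z, (1 / n : ℂ) * ∑ j, Laplacian.laplacian φ z * (Real.log ‖z - b j‖ : ℂ)
      = Laplacian.laplacian φ z * ((Real.log ‖meanPoly x n z‖ / n : ℝ) : ℂ) := by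
    filter_upwards [ae_log_norm_prod_eq b] with z hz
    rw [hb, hz, ← Finset.mul_sum]
    push_cast
    ring
  have hsum : Integrable fun z =>
      (1 / n : ℂ) * ∑ j, Laplacian.laplacian φ z * (Real.log ‖z - b j‖ : ℂ) :=
    (integrable_finsetSum _ fun j _ => hi j).const_mul _
  refine ⟨hsum.congr hae, ?_⟩
  rw [havg, ← integral_congr_ae hae, integral_const_mul, integral_finsetSum _ fun j _ => hi j,
    mul_left_comm]
  congr 1
  rw [Finset.mul_sum]
  exact Finset.sum_congr rfl fun j _ => integral_laplacian_mul_log_norm_sub_complex hφ (b j)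

/-! ### Convergence of the zeros -/

/-- A bound in `L²` upgrades convergence to zero in probability, at almost every point, to
convergence in `L¹` of the product space. -/
lemma tendsto_lintegral_lintegral_of_sq_bounded {E Ω : Type*} [MeasurableSpace E]
    [MeasurableSpace Ω] {κ : Measure E} [IsFiniteMeasure κ] {P : Measure Ω} [IsProbabilityMeasure P]
    {h : ℕ → Ω → E → ℝ} (hm : ∀ n, Measurable (Function.uncurry (h n))) {B : ℝ≥0∞} (hB : B ≠ ∞)
    (hsq : ∀ᶠ n in atTop, ∀ᵐ ω ∂P, ∫⁻ z, ENNReal.ofReal (h n ω z ^ 2) ∂κ ≤ B)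
    (hlim : ∀ᵐ z ∂κ, ∀ ε > 0, Tendsto (fun n => P {ω | ε ≤ |h n ω z|}) atTop (𝓝 0)) :
    Tendsto (fun n => ∫⁻ ω, ∫⁻ z, ENNReal.ofReal |h n ω z| ∂κ ∂P) atTop (𝓝 0) := by
  rw [ENNReal.tendsto_nhds_zero]
  intro η hη
  obtain ⟨s, hs, hsη⟩ := ENNReal.exists_nnreal_pos_mul_lt
    (ENNReal.add_ne_top.2 ⟨measure_ne_top κ Set.univ, hB⟩) (ENNReal.half_pos hη.ne').ne'
  have hs' : (0 : ℝ) < s := hs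
  set T : ℕ → Set (Ω × E) := fun n => {p | (s : ℝ) ≤ |h n p.1 p.2|}
  have hT : ∀ n, MeasurableSet (T n) := fun n => measurableSet_le measurable_const (hm n).norm
  have hlim' : Tendsto (fun n => ENNReal.ofReal (1 / (4 * s)) * ∫⁻ z, P {ω | (s : ℝ) ≤ |h n ω z|} ∂κ)
      atTop (𝓝 0) := by
    have h1 : Tendsto (fun n => ∫⁻ z, P {ω | (s : ℝ) ≤ |h n ω z|} ∂κ) atTop
        (𝓝 (∫⁻ _, 0 ∂κ)) := by
      refine tendsto_lintegral_of_dominated_convergence (fun _ => 1)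
        (fun n => measurable_measure_prodMk_right (hT n))
        (fun n => ae_of_all _ fun z => prob_le_one) (by simp) ?_
      filter_upwards [hlim] with z hz using hz s hs'
    rw [lintegral_zero] at h1
    have h2 := ENNReal.Tendsto.const_mul h1 (a := ENNReal.ofReal (1 / (4 * s)))
      (Or.inr ENNReal.ofReal_ne_top)
    rwa [mul_zero] at h2
  filter_upwards [hsq, (ENNReal.tendsto_nhds_zero.1 hlim') (η / 2) (ENNReal.half_pos hη.ne')]
    with n hn hn'
  have hpt : ∀ ω z, ENNReal.ofReal |h n ω z| ≤ s
      + (ENNReal.ofReal (1 / (4 * s)) * (T n).indicator 1 (ω, z)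
        + s * ENNReal.ofReal (h n ω z ^ 2)) := by
    intro ω z
    by_cases hz : (ω, z) ∈ T n
    · -- the inequality between the two means gives `|x| ≤ 1 / (4 s) + s x²`
      have h1 : |h n ω z| ≤ 1 / (4 * s) + s * h n ω z ^ 2 := by
        have h2 : 1 / (4 * (s : ℝ)) + s * h n ω z ^ 2 - |h n ω z|
            = s * (|h n ω z| - 1 / (2 * s)) ^ 2 := by
          rw [← sq_abs (h n ω z)]
          field_simp
          ring
        have h3 : 0 ≤ s * (|h n ω z| - 1 / (2 * s)) ^ 2 := by positivity
        linarith
      rw [Set.indicator_of_mem hz, Pi.one_apply, mul_one]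
      refine le_add_left ?_
      refine (ENNReal.ofReal_le_ofReal h1).trans_eq ?_
      rw [ENNReal.ofReal_add (by positivity) (by positivity), ENNReal.ofReal_mul hs'.le,
        ENNReal.ofReal_coe_nnreal]
    · have hz' : |h n ω z| < s := not_le.1 hz
      refine le_add_right ?_
      rw [← ENNReal.ofReal_coe_nnreal]
      exact ENNReal.ofReal_le_ofReal hz'.le
  have hmi : Measurable ((T n).indicator (1 : Ω × E → ℝ≥0∞)) := measurable_one.indicator (hT n)
  have hmi' : ∀ ω, Measurable fun z => (T n).indicator (1 : Ω × E → ℝ≥0∞) (ω, z) := fun ω =>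
    hmi.comp measurable_prodMk_left
  have hswap : ∫⁻ ω, ∫⁻ z, (T n).indicator 1 (ω, z) ∂κ ∂P = ∫⁻ z, P {ω | (s : ℝ) ≤ |h n ω z|} ∂κ := by
    rw [lintegral_lintegral_swap (f := fun ω z => (T n).indicator 1 (ω, z)) hmi.aemeasurable]
    refine lintegral_congr fun z => ?_
    exact lintegral_indicator_one (μ := P) (s := {ω | (s : ℝ) ≤ |h n ω z|})
      (measurable_prodMk_right (hT n))
  calc ∫⁻ ω, ∫⁻ z, ENNReal.ofReal |h n ω z| ∂κ ∂P
      ≤ ∫⁻ ω, (s * κ Set.univ + (ENNReal.ofReal (1 / (4 * s)) * ∫⁻ z, (T n).indicator 1 (ω, z) ∂κ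
          + s * B)) ∂P := by
        refine lintegral_mono_ae ?_
        filter_upwards [hn] with ω hω
        refine (lintegral_mono fun z => hpt ω z).trans ?_
        rw [lintegral_add_left measurable_const, lintegral_const,
          lintegral_add_left ((hmi' ω).const_mul _), lintegral_const_mul _ (hmi' ω),
          lintegral_const_mul' _ _ ENNReal.coe_ne_top]
        gcongr
    _ = s * (κ Set.univ + B)
          + ENNReal.ofReal (1 / (4 * s)) * ∫⁻ z, P {ω | (s : ℝ) ≤ |h n ω z|} ∂κ := by
        rw [lintegral_add_left measurable_const, lintegral_add_right _ measurable_const,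
          lintegral_const, lintegral_const, measure_univ (μ := P), mul_one, mul_one,
          lintegral_const_mul' _ _ ENNReal.ofReal_ne_top, hswap]
        ring
    _ ≤ η / 2 + η / 2 := add_le_add hsη.le hn'
    _ = η := ENNReal.add_halves η

/-- Uniformly in `n`, the difference between the normalized potential of the zeros and `U` is
bounded in `L²` of every disc. -/
lemma exists_lintegral_sq_log_meanPoly_sub_le {m : ℕ} [NeZero m] {μ : Fin m → Measure ℂ}
    [∀ k, IsProbabilityMeasure (μ k)] (h : ∀ k, IsCompact (μ k).support) (R S : ℝ) :
    ∃ B : ℝ≥0∞, B ≠ ∞ ∧ ∀ (x : ℕ → Fin m → ℂ), (∀ i k, ‖x i k‖ ≤ S) → ∀ n : ℕ, 0 < n →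
      ∫⁻ z in Metric.closedBall 0 R,
        ENNReal.ofReal ((Real.log ‖meanPoly x n z‖ / n - realMaxPotential μ z) ^ 2) ≤ B := by
  set A := ENNReal.ofReal (2 * Real.posLog (R + S) ^ 2) * volume (Metric.closedBall (0 : ℂ) R)
        + ENNReal.ofReal 8 * ∫⁻ z : ℂ, ENNReal.ofReal (Real.posLog ‖z‖⁻¹ ^ 2)
  have hU : Integrable (fun z => realMaxPotential μ z ^ 2) (volume.restrict (Metric.closedBall 0 R)) :=
    (memLp_realMaxPotential h R).integrable_sq
  have hmU := measurable_realMaxPotential μ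
  refine ⟨2 * A + 2 * ∫⁻ z in Metric.closedBall 0 R, ENNReal.ofReal (realMaxPotential μ z ^ 2),
    ?_, fun x hx n hn => ?_⟩
  · have hA : A ≠ ∞ := ENNReal.add_ne_top.2
      ⟨ENNReal.mul_ne_top ENNReal.ofReal_ne_top measure_closedBall_lt_top.ne,
        ENNReal.mul_ne_top ENNReal.ofReal_ne_top
          integrable_sq_posLog_inv_norm.lintegral_lt_top.ne⟩
    exact ENNReal.add_ne_top.2 ⟨ENNReal.mul_ne_top (by simp) hA,
      ENNReal.mul_ne_top (by simp) hU.lintegral_lt_top.ne⟩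
  · calc ∫⁻ z in Metric.closedBall 0 R,
          ENNReal.ofReal ((Real.log ‖meanPoly x n z‖ / n - realMaxPotential μ z) ^ 2)
        ≤ ∫⁻ z in Metric.closedBall 0 R, (2 * ENNReal.ofReal ((Real.log ‖meanPoly x n z‖ / n) ^ 2)
          + 2 * ENNReal.ofReal (realMaxPotential μ z ^ 2)) := by
          refine lintegral_mono fun z => ?_
          rw [← ENNReal.ofReal_ofNat 2, ← ENNReal.ofReal_mul (by norm_num),
            ← ENNReal.ofReal_mul (by norm_num), ← ENNReal.ofReal_add (by positivity) (by positivity)]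
          refine ENNReal.ofReal_le_ofReal ?_
          nlinarith [sq_nonneg (Real.log ‖meanPoly x n z‖ / n + realMaxPotential μ z)]
      _ ≤ _ := by
          rw [lintegral_add_right _ (by fun_prop), lintegral_const_mul' _ _ (by simp),
            lintegral_const_mul' _ _ (by simp)]
          gcongr
          exact lintegral_sq_log_meanPoly_div_le hx hn

/-- The deviation of the averages over the zeros is controlled by the `L¹` distance of the
potentials on the support of the test function. -/
lemma IsTestFunction.exists_enorm_rootAverage_sub_le {m : ℕ} [NeZero m] {V : ℂ → ℝ} {φ : ℂ → ℂ}
    (hφ : IsTestFunction φ) (hV : LocallyIntegrable V) :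
    ∃ D : ℝ≥0∞, D ≠ ∞ ∧ ∀ (x : ℕ → Fin m → ℂ) (n : ℕ),
      ‖rootAverage φ (∑ k, rootPoly (fun i => x i k) n) n
          - (1 / (2 * π) : ℂ) * ∫ z, Laplacian.laplacian φ z * (V z : ℂ)‖ₑ
        ≤ D * ∫⁻ z in tsupport φ, ENNReal.ofReal |Real.log ‖meanPoly x n z‖ / n - V z| := by
  obtain ⟨D, hD, hφD⟩ := hφ.exists_norm_laplacian_le
  refine ⟨‖(1 / (2 * π) : ℂ)‖ₑ * ENNReal.ofReal D,
    ENNReal.mul_ne_top enorm_ne_top ENNReal.ofReal_ne_top, fun x n => ?_⟩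
  obtain ⟨hi, he⟩ := rootAverage_eq_integral_laplacian x n hφ
  rw [he, ← mul_sub, ← integral_sub hi (hφ.integrable_laplacian_mul hV), enorm_mul, mul_assoc]
  refine mul_le_mul' le_rfl ((enorm_integral_le_lintegral_enorm _).trans ?_)
  rw [← lintegral_const_mul' _ _ ENNReal.ofReal_ne_top,
    ← lintegral_indicator (isClosed_tsupport φ).measurableSet]
  refine lintegral_mono fun z => ?_
  rw [← mul_sub, ← Complex.ofReal_sub]
  by_cases hz : z ∈ tsupport φ
  · rw [Set.indicator_of_mem hz, enorm_mul, ← ofReal_norm, ← ofReal_norm, Complex.norm_real,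
      Real.norm_eq_abs]
    gcongr
    exact hφD z
  · simp [laplacian_eq_zero_of_notMem_tsupport hz]

/-- Convergence of the averages over the zeros, for samples given by measurable functions. The only
probabilistic hypothesis is that, at almost every point of the support of `φ`, no two of the
polynomials stay of comparable size. -/
theorem tendstoInMeasure_rootAverage {Ω : Type*} [MeasurableSpace Ω] {P : Measure Ω}
    [IsProbabilityMeasure P] {m : ℕ} [NeZero m] {μ : Fin m → Measure ℂ}
    [∀ k, IsProbabilityMeasure (μ k)] (h : ∀ k, IsCompact (μ k).support)
    {Y : ℕ → Fin m → Ω → ℂ} (hY : ∀ i k, Measurable (Y i k)) (hlaw : ∀ i k, P.map (Y i k) = μ k)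
    (hind : iIndepFun (fun ik : ℕ × Fin m => Y ik.1 ik.2) P) {φ : ℂ → ℂ} (hφ : IsTestFunction φ)
    (hsep : ∀ᵐ z, z ∈ tsupport φ → ∀ k l : Fin m, k < l → ∀ M : ℝ, Tendsto (fun n : ℕ =>
      P {ω | |∑ i ∈ Finset.range n, Real.log ‖z - Y i k ω‖
        - ∑ i ∈ Finset.range n, Real.log ‖z - Y i l ω‖| ≤ M}) atTop (𝓝 0)) :
    TendstoInMeasure P (fun (n : ℕ) ω => rootAverage φ (∑ k, rootPoly (fun i => Y i k ω) n) n) atTop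
      (fun _ => (1 / (2 * π) : ℂ) * ∫ z, Laplacian.laplacian φ z * (realMaxPotential μ z : ℂ)) := by
  obtain ⟨R, hR⟩ := hφ.2.isBounded.subset_closedBall (0 : ℂ)
  obtain ⟨S, -, hS⟩ := exists_forall_ae_norm_le h
  obtain ⟨B, hB, hBle⟩ := exists_lintegral_sq_log_meanPoly_sub_le h R S
  obtain ⟨D, hD, hDle⟩ := hφ.exists_enorm_rootAverage_sub_le (m := m)
    (locallyIntegrable_realMaxPotential h)
  have hmU := measurable_realMaxPotential μ
  set κ := (volume : Measure ℂ).restrict (tsupport φ)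
  have : IsFiniteMeasure κ := ⟨by
    rw [Measure.restrict_apply_univ]
    exact hφ.2.isCompact.measure_lt_top⟩
  set H : ℕ → Ω → ℂ → ℝ := fun n ω z =>
    Real.log ‖meanPoly (fun i k => Y i k ω) n z‖ / n - realMaxPotential μ z with hH
  have hHm : ∀ n, Measurable (Function.uncurry (H n)) := fun n => by
    have h1 : Measurable fun p : Ω × ℂ => meanPoly (fun i k => Y i k p.1) n p.2 := by
      unfold meanPoly
      refine Measurable.div_const (Finset.measurable_fun_sum _ fun k _ =>
        Finset.measurable_fun_prod _ fun i _ => ?_) _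
      exact measurable_snd.sub ((hY i k).comp measurable_fst)
    exact ((Real.measurable_log.comp h1.norm).div_const _).sub (hmU.comp measurable_snd)
  have hbdd : ∀ᵐ ω ∂P, ∀ i k, ‖Y i k ω‖ ≤ S := by
    refine ae_all_iff.2 fun i => ae_all_iff.2 fun k => ?_
    have := hS k
    rw [← hlaw i k] at this
    exact ae_of_ae_map (hY i k).aemeasurable this
  have hL1 : Tendsto (fun n => ∫⁻ ω, ∫⁻ z, ENNReal.ofReal |H n ω z| ∂κ ∂P) atTop (𝓝 0) := by
    refine tendsto_lintegral_lintegral_of_sq_bounded hHm hB ?_ ?_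
    · filter_upwards [eventually_gt_atTop 0] with n hn
      filter_upwards [hbdd] with ω hω
      exact (lintegral_mono_set hR).trans (hBle _ hω n hn)
    · rw [ae_restrict_iff' (isClosed_tsupport φ).measurableSet]
      filter_upwards [hsep, ae_isRegularPoint h] with z hz hreg hzφ ε hε
      exact tendsto_measure_log_meanPoly hY hlaw hind hreg (hz hzφ) hε
  have hDL : Tendsto (fun n => D * ∫⁻ ω, ∫⁻ z, ENNReal.ofReal |H n ω z| ∂κ ∂P) atTop (𝓝 0) := by
    simpa using ENNReal.Tendsto.const_mul hL1 (Or.inr hD)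
  refine tendstoInMeasure_of_ne_top fun ε hε hε' => ?_
  have hlim := ENNReal.Tendsto.div_const hDL (b := ε) (Or.inr hε.ne')
  rw [ENNReal.zero_div] at hlim
  refine tendsto_of_tendsto_of_tendsto_of_le_of_le tendsto_const_nhds hlim (fun _ => zero_le)
    fun n => ?_
  have hmeas : Measurable fun ω => ∫⁻ z, ENNReal.ofReal |H n ω z| ∂κ :=
    Measurable.lintegral_prod_right' (hHm n).norm.ennreal_ofReal
  beta_reduce
  rw [← lintegral_const_mul _ hmeas]
  refine (measure_mono fun ω hω => ?_).trans
    (meas_ge_le_lintegral_div (hmeas.const_mul D).aemeasurable hε.ne' hε')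
  have hω' : ε ≤ edist _ _ := hω
  rw [edist_eq_enorm_sub] at hω'
  exact hω'.trans (hDle _ n)

theorem mainTheorem2 (m : ℕ) (hm : 2 ≤ m) (μ : Fin m → Measure ℂ)
    (hprob : ∀ k, IsProbabilityMeasure (μ k)) (hcpt : ∀ k, IsCompact (μ k).support) :
    ∃ ρ : Measure ℂ, IsProbabilityMeasure ρ ∧
      IsDistribLaplacianOver2Pi ρ (maxLogPotential μ) ∧
      (∀ ρ' : Measure ℂ, IsLocallyFiniteMeasure ρ' →
        IsDistribLaplacianOver2Pi ρ' (maxLogPotential μ) → ρ' = ρ) ∧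
      ∀ φ : ℂ → ℂ, IsTestFunction φ →
        ((∀ k : Fin m, (k : ℕ) + 1 < m → ¬ SupportedOnCircleCenteredIn (μ k) (tsupport φ)) ∨
          (∀ k l : Fin m, k < l → PotentialsSeparatedOn (μ k) (μ l) (tsupport φ))) →
        ∀ (Ω : Type*) (_ : MeasurableSpace Ω) (P : Measure Ω) (_ : IsProbabilityMeasure P)
          (X : ℕ → Fin m → Ω → ℂ),
          (∀ i k, HasLaw (X i k) (μ k) P) →
          iIndepFun (fun ik : ℕ × Fin m => X ik.1 ik.2) P →
          TendstoInMeasure P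
            (fun (n : ℕ) ω => rootAverage φ (∑ k, rootPoly (fun i => X i k ω) n) n)
            atTop (fun _ => ∫ z, φ z ∂ρ) := by
  have : NeZero m := ⟨by omega⟩
  obtain ⟨ρ, hρ, hint⟩ := exists_isProbabilityMeasure_integral_eq hcpt
  refine ⟨ρ, hρ, (isDistribLaplacianOver2Pi_maxLogPotential_iff hcpt ρ).2 hint,
    fun ρ' hfin hρ' => ?_, ?_⟩
  · rw [isDistribLaplacianOver2Pi_maxLogPotential_iff hcpt ρ'] at hρ'
    exact measure_ext_of_integral_isTestFunction fun φ hφ => (hρ' φ hφ).trans (hint φ hφ).symm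
  intro φ hφ hcond Ω _ P _ X hX hind
  -- the laws only determine the samples up to null sets: pass to measurable versions
  set Y : ℕ → Fin m → Ω → ℂ := fun i k => (hX i k).aemeasurable.mk
  have hXY : ∀ i k, X i k =ᵐ[P] Y i k := fun i k => (hX i k).aemeasurable.ae_eq_mk
  have hY : ∀ i k, Measurable (Y i k) := fun i k => (hX i k).aemeasurable.measurable_mk
  have hlaw : ∀ i k, P.map (Y i k) = μ k := fun i k =>
    (Measure.map_congr (hXY i k)).symm.trans (hX i k).map_eq
  have hindY : iIndepFun (fun ik : ℕ × Fin m => Y ik.1 ik.2) P :=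
    hind.congr fun ik => hXY ik.1 ik.2
  have hall : ∀ᵐ ω ∂P, ∀ i k, X i k ω = Y i k ω :=
    ae_all_iff.2 fun i => ae_all_iff.2 fun k => hXY i k
  rw [hint φ hφ]
  refine TendstoInMeasure.congr (fun n => ?_) EventuallyEq.rfl
    (tendstoInMeasure_rootAverage hcpt hY hlaw hindY hφ ?_)
  · filter_upwards [hall] with ω hω
    simp only [hω]
  rcases hcond with hcirc | hpot
  · filter_upwards [ae_isRegularPoint hcpt] with z hz hzφ k l hkl M
    have hk : (k : ℕ) + 1 < m := by
      have := l.2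
      have : (k : ℕ) < l := hkl
      omega
    exact tendsto_measure_of_not_supportedOnCircle hY hlaw hindY hz hzφ hkl.ne (hcirc k hk) M
  · have hne : ∀ᵐ z, ∀ k l : Fin m, k < l → z ∈ tsupport φ →
        realPotential (μ k) z ≠ realPotential (μ l) z :=
      ae_all_iff.2 fun k => ae_all_iff.2 fun l => ae_all_iff.2 fun hkl =>
        ae_realPotential_ne_of_potentialsSeparatedOn (hcpt k) (hcpt l) (hpot k l hkl)
    filter_upwards [ae_isRegularPoint hcpt, hne] with z hz hz' hzφ k l hkl M
    exact tendsto_measure_of_realPotential_ne hY hlaw hindY hz (hz' k l hkl hzφ) M
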